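/- A hypergraph $\mathcal H$ consists of a finite vertex set $V(\mathcal H)$ and a set $E(\mathcal H)$ of subsets of $V(\mathcal H)$, called edges (there are no repeated edges); it is $r$-uniform if every edge has exactly $r$ vertices. A Berge cycle of length $k$ in $\mathcal H$ consists of $k$ distinct vertices $v_0,\dots,v_{k-1}$ and $k$ distinct edges $e_0,\dots,e_{k-1}$ of $\mathcal H$ with $\{v_i,v_{i+1}\}\subseteq e_i$ for all $0\le i\le k-1$, where indices are taken modulo $k$; write $E(C)$ for the set of edges of a Berge cycle $C$. If $\mathcal H$ has $n$ vertices, a Berge cycle of length $n$ is called hamiltonian, and $\mathcal H$ is called pancyclic if it contains a Berge cycle of every length $k$ with $2\le k\le n$. **Theorem.** Let $n$ and $r$ be integers with $r\ge 3$ and $r\ge\lfloor (n-1)/2\rfloor$. Let $\mathcal H$ be an $n$-vertex $r$-uniform hypergraph with a hamiltonian Berge cycle $C$. Define $$c_r=\begin{cases}6 & \text{if } r=\lfloor (n-1)/2\rfloor,\\ 1 & \text{if } r\ge n/2.\end{cases}$$ If some vertex $v$ of $\mathcal H$ is contained in at least $c_r$ edges of $E(\mathcal H)\setminus E(C)$,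 then $\mathcal H$ is pancyclic. -/

import Mathlib

/-- `H` is `r`-uniform: every edge contains exactly `r` vertices. The edge must be finite, so that
for `r = 0` an infinite edge (whose `ncard` is `0`) is not accepted. -/
def Hypergraph.IsUniformOfSize {α : Type*} (H : Hypergraph α) (r : ℕ) : Prop :=
  ∀ e ∈ H.edgeSet, e.Finite ∧ e.ncard = r

/-- A Berge cycle of length `k` in `H`: distinct vertices `v₀, …, v_{k-1}` and distinct edges
`e₀, …, e_{k-1}` of `H` with `{v_i, v_{i+1}} ⊆ e_i` for all `i`, indices modulo `k`
(`finRotate k` is the cyclic successor on `Fin k`). -/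
structure Hypergraph.BergeCycle {α : Type*} (H : Hypergraph α) (k : ℕ) where
  vert : Fin k → α
  edge : Fin k → Set α
  vert_injective : Function.Injective vert
  edge_injective : Function.Injective edge
  edge_mem : ∀ i, edge i ∈ H.edgeSet
  pair_subset : ∀ i, {vert i, vert (finRotate k i)} ⊆ edge i

/-- The set `E(C)` of edges used by a Berge cycle `C`. -/
def Hypergraph.BergeCycle.edges {α : Type*} {H : Hypergraph α} {k : ℕ}
    (C : H.BergeCycle k) : Set (Set α) :=
  Set.range C.edge

/-- `H` is pancyclic: it contains Berge cycles of every length from `2` to its number of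
vertices (for hypergraphs with finite vertex set). -/
def Hypergraph.IsPancyclic {α : Type*} (H : Hypergraph α) : Prop :=
  ∀ k : ℕ, 2 ≤ k → k ≤ H.vertexSet.ncard → Nonempty (H.BergeCycle k)

/-- The constant `c_r` (for given `n`): it is `6` if `r = ⌊(n-1)/2⌋` and `1` if `r ≥ n/2`.
For `n ≥ 1` these two cases exhaust all `r ≥ ⌊(n-1)/2⌋`; see the two lemmas below. -/
def extraEdgeBound (n r : ℕ) : ℕ :=
  if r = (n - 1) / 2 then 6 else 1

theorem extraEdgeBound_eq_six {n r : ℕ} (h : r = (n - 1) / 2) : extraEdgeBound n r = 6 :=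
  if_pos h

theorem extraEdgeBound_eq_one {n r : ℕ} (hn : 1 ≤ n) (h : (n : ℚ) / 2 ≤ r) :
    extraEdgeBound n r = 1 := by
  have h' : (n : ℚ) ≤ (2 * r : ℕ) := by push_cast; linarith
  have h'' : n ≤ 2 * r := by exact_mod_cast h'
  exact if_neg (by omega)

/-! Number the vertices along the hamiltonian cycle by `ZMod n`, and suppose that no Berge cycle has
length `d + 1 < n`; put `e = n - d`. An arc of the cycle closed by one further edge, or two arcs
linked by two further edges, is a Berge cycle, so a missing length forbids configurations. The basic
one: an extra edge (one outside the cycle) never contains both `x` and `x + d`, nor both `x` and `x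
+ e`.

If `n ≤ 2 * r`, this forces `n = 2 * r` and makes an extra edge `A` complementary to its translate
by `d`. If `i` and `i + 1` were both in `A`, then `A` and `S.e i` could be exchanged on the cycle,
and comparing the two gives `A = S.e i`. So `A` alternates. An arc closed by `A` then has any odd
length, and a third vertex of a cycle edge helps to build every even length
(`IsExtra.hasBergeCycle_of_le_two_mul`).

If `r = (n - 1) / 2`, rotate so that the given vertex is `0` and take six extra edges through it,
with union `U`. Comparison with `S.e 0` gives `U.card ≤ r + 3` (`card_add_le_of_forall_mem_extra`).
Three extra edges inside an `r + 1`-set already yield the cycle (`IsSunflower.hasBergeCycle`), which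
rules out smaller unions, so `n = 2 * r + 2` and `U.card = r + 3` (`exists_isSixfold`). Each of the
six edges is `U` minus three vertices that meet every pair of `U` at distance `e`, and by counting
there are many such pairs. When `d = e` they conflict with the common vertex `0`
(`false_of_antipodal`). When `d ≠ e` the six edges must be complements of the six triples covering a
four-vertex path and a separate pair (`exists_isPathPair`). Any two elements of `U` not at distance
`e` then share an edge, so the forbidden configurations apply to `U` itself, which cannot satisfy
them. -/

/-! ### Berge cycles made of arcs of the hamiltonian cycle. -/

/-- A family `E` of subsets of `ZMod n` contains a Berge cycle of length `k`. -/
def HasBergeCycle {n : ℕ} (E : Set (Finset (ZMod n))) (k : ℕ) : Prop :=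
  ∃ (v : Fin k → ZMod n) (g : Fin k → Finset (ZMod n)), Function.Injective v ∧
    Function.Injective g ∧ ∀ i, g i ∈ E ∧ v i ∈ g i ∧ v (finRotate k i) ∈ g i

theorem HasBergeCycle.of_nat {n : ℕ} {E : Set (Finset (ZMod n))} {k : ℕ} (hk : 0 < k)
    (v : ℕ → ZMod n) (g : ℕ → Finset (ZMod n))
    (hv : ∀ i j, i < j → j < k → v i ≠ v j) (hg : ∀ i j, i < j → j < k → g i ≠ g j)
    (hE : ∀ i < k, g i ∈ E) (h1 : ∀ i < k, v i ∈ g i) (h2 : ∀ i, i + 1 < k → v (i + 1) ∈ g i)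
    (h3 : v 0 ∈ g (k - 1)) : HasBergeCycle E k := by
  obtain ⟨m, rfl⟩ : ∃ m, k = m + 1 := ⟨k - 1, by omega⟩
  refine ⟨fun i => v i, fun i => g i, ?_, ?_, ?_⟩
  · intro i j h
    by_contra hij
    rcases lt_or_gt_of_ne (fun h' => hij (Fin.ext h')) with h' | h'
    · exact hv _ _ h' j.2 h
    · exact hv _ _ h' i.2 h.symm
  · intro i j h
    by_contra hij
    rcases lt_or_gt_of_ne (fun h' => hij (Fin.ext h')) with h' | h'
    · exact hg _ _ h' j.2 h
    · exact hg _ _ h' i.2 h.symm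
  · intro i
    refine ⟨hE _ i.2, h1 _ i.2, ?_⟩
    by_cases hi : i = Fin.last m
    · subst hi
      simpa using h3
    · have hi' : (i : ℕ) < m := by
        have := i.2
        have : (i : ℕ) ≠ m := fun h => hi (Fin.ext h)
        omega
      have := coe_finRotate_of_ne_last hi
      change v ((finRotate (m + 1) i : Fin (m + 1)) : ℕ) ∈ g i
      rw [this]
      exact h2 _ (by omega)

theorem ZMod.natCast_ne_of_lt {n i j : ℕ} (hij : i < j) (hj : j < n) :
    (i : ZMod n) ≠ (j : ZMod n) := by
  intro h
  rw [ZMod.natCast_eq_natCast_iff'] at h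
  rw [Nat.mod_eq_of_lt hj, Nat.mod_eq_of_lt (by omega)] at h
  omega

theorem ZMod.natCast_inj_of_lt {n i j : ℕ} (hi : i < n) (hj : j < n)
    (h : (i : ZMod n) = (j : ZMod n)) : i = j := by
  by_contra hne
  rcases lt_or_gt_of_ne hne with h' | h'
  · exact ZMod.natCast_ne_of_lt h' hj h
  · exact ZMod.natCast_ne_of_lt h' hi h.symm

/-- A uniform family of subsets of `ZMod n` with a hamiltonian Berge cycle on `0, 1, …, n - 1`. -/
structure HamSystem (n r : ℕ) where
  E : Set (Finset (ZMod n))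
  e : ZMod n → Finset (ZMod n)
  e_injective : Function.Injective e
  e_mem : ∀ i, e i ∈ E
  left_mem : ∀ i, i ∈ e i
  right_mem : ∀ i, i + 1 ∈ e i
  card_eq : ∀ f ∈ E, f.card = r

namespace HamSystem

variable {n r : ℕ} (S : HamSystem n r)

/-- Two disjoint arcs of the hamiltonian cycle, joined end-to-start twice. -/
theorem cycle_of_parallel_arcs {k : ℕ} (a : ZMod n) (p s t : ℕ) (hps : p < s) (hst : s ≤ t)
    (htn : t < n) (hk : k = (p + 1) + (t - s + 1)) {f g : Finset (ZMod n)} (hf : f ∈ S.E)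
    (hg : g ∈ S.E) (hfg : f ≠ g)
    (hfe : ∀ j : ℕ, j < p ∨ (s ≤ j ∧ j < t) → S.e (a + j) ≠ f)
    (hge : ∀ j : ℕ, j < p ∨ (s ≤ j ∧ j < t) → S.e (a + j) ≠ g)
    (h1 : a + p ∈ f) (h2 : a + s ∈ f) (h3 : a + t ∈ g) (h4 : a ∈ g) : HasBergeCycle S.E k := by
  subst hk
  have inj : ∀ i j : ℕ, i < n → j < n → i ≠ j → a + (i : ZMod n) ≠ a + j := by
    intro i j hi hj hij h
    exact hij (ZMod.natCast_inj_of_lt hi hj (add_left_cancel h))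
  have einj : ∀ i j : ℕ, i < n → j < n → i ≠ j → S.e (a + (i : ZMod n)) ≠ S.e (a + j) :=
    fun i j hi hj hij h => inj i j hi hj hij (S.e_injective h)
  refine HasBergeCycle.of_nat (by omega)
    (fun j => if j ≤ p then a + (j : ZMod n) else a + ((s + (j - (p + 1)) : ℕ) : ZMod n))
    (fun j => if j < p then S.e (a + (j : ZMod n)) else if j = p then f else
      if j < p + 1 + (t - s) then S.e (a + ((s + (j - (p + 1)) : ℕ) : ZMod n)) else g)
    ?_ ?_ ?_ ?_ ?_ ?_
  · intro i j hij hj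
    split_ifs <;> first | omega | exact inj _ _ (by omega) (by omega) (by omega)
  · intro i j hij hj
    split_ifs <;> first
      | omega
      | exact einj _ _ (by omega) (by omega) (by omega)
      | exact hfe _ (by omega)
      | exact hge _ (by omega)
      | exact (hfe _ (by omega)).symm
  · intro i hi
    split_ifs <;> first | exact S.e_mem _ | assumption
  · intro i hi
    split_ifs <;> first
      | omega
      | exact S.left_mem _
      | (subst_vars; assumption)
      | (have : s + (i - (p + 1)) = t := by omega
         rw [this]; assumption)
  · intro i hi
    split_ifs <;> first
      | omega
      | (have := S.right_mem (a + (i : ZMod n)); push_cast; rwa [← add_assoc])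
      | (have : s + (i + 1 - (p + 1)) = s := by omega
         rw [this]; assumption)
      | (have h := S.right_mem (a + ((s + (i - (p + 1)) : ℕ) : ZMod n))
         have h' : s + (i + 1 - (p + 1)) = s + (i - (p + 1)) + 1 := by omega
         rw [h', Nat.cast_succ, ← add_assoc]; exact h)
  · have : ¬ (p + 1 + (t - s + 1) - 1 < p) ∧ ¬ (p + 1 + (t - s + 1) - 1 = p) ∧
        ¬ (p + 1 + (t - s + 1) - 1 < p + 1 + (t - s)) := by omega
    rw [if_neg this.1, if_neg this.2.1, if_neg this.2.2]
    simpa using h4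

/-- Two disjoint arcs of the hamiltonian cycle, joined end-to-end and start-to-start. -/
theorem cycle_of_crossed_arcs {k : ℕ} (a : ZMod n) (p s t : ℕ) (hps : p < s) (hst : s ≤ t)
    (htn : t < n) (hk : k = (p + 1) + (t - s + 1)) {f g : Finset (ZMod n)} (hf : f ∈ S.E)
    (hg : g ∈ S.E) (hfg : f ≠ g)
    (hfe : ∀ j : ℕ, j < p ∨ (s ≤ j ∧ j < t) → S.e (a + j) ≠ f)
    (hge : ∀ j : ℕ, j < p ∨ (s ≤ j ∧ j < t) → S.e (a + j) ≠ g)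
    (h1 : a + p ∈ f) (h2 : a + t ∈ f) (h3 : a + s ∈ g) (h4 : a ∈ g) : HasBergeCycle S.E k := by
  subst hk
  have inj : ∀ i j : ℕ, i < n → j < n → i ≠ j → a + (i : ZMod n) ≠ a + j := by
    intro i j hi hj hij h
    exact hij (ZMod.natCast_inj_of_lt hi hj (add_left_cancel h))
  have einj : ∀ i j : ℕ, i < n → j < n → i ≠ j → S.e (a + (i : ZMod n)) ≠ S.e (a + j) :=
    fun i j hi hj hij h => inj i j hi hj hij (S.e_injective h)
  refine HasBergeCycle.of_nat (by omega)
    (fun j => if j ≤ p then a + (j : ZMod n) else a + ((t - (j - (p + 1)) : ℕ) : ZMod n))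
    (fun j => if j < p then S.e (a + (j : ZMod n)) else if j = p then f else
      if j < p + 1 + (t - s) then S.e (a + ((t - 1 - (j - (p + 1)) : ℕ) : ZMod n)) else g)
    ?_ ?_ ?_ ?_ ?_ ?_
  · intro i j hij hj
    split_ifs <;> first | omega | exact inj _ _ (by omega) (by omega) (by omega)
  · intro i j hij hj
    split_ifs <;> first
      | omega
      | exact einj _ _ (by omega) (by omega) (by omega)
      | exact hfe _ (by omega)
      | exact hge _ (by omega)
      | exact (hfe _ (by omega)).symm
  · intro i hi
    split_ifs <;> first | exact S.e_mem _ | assumption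
  · intro i hi
    split_ifs <;> first
      | omega
      | exact S.left_mem _
      | (subst_vars; assumption)
      | (have h := S.right_mem (a + ((t - 1 - (i - (p + 1)) : ℕ) : ZMod n))
         have h' : t - (i - (p + 1)) = t - 1 - (i - (p + 1)) + 1 := by omega
         rw [h', Nat.cast_succ, ← add_assoc]; exact h)
      | (have : t - (i - (p + 1)) = s := by omega
         rw [this]; assumption)
  · intro i hi
    split_ifs <;> first
      | omega
      | (have := S.right_mem (a + (i : ZMod n)); push_cast; rwa [← add_assoc])
      | (have : t - (i + 1 - (p + 1)) = t := by omega
         rw [this]; assumption)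
      | (have h := S.left_mem (a + ((t - 1 - (i - (p + 1)) : ℕ) : ZMod n))
         have h' : t - (i + 1 - (p + 1)) = t - 1 - (i - (p + 1)) := by omega
         rw [h']; exact h)
  · have : ¬ (p + 1 + (t - s + 1) - 1 < p) ∧ ¬ (p + 1 + (t - s + 1) - 1 = p) ∧
        ¬ (p + 1 + (t - s + 1) - 1 < p + 1 + (t - s)) := by omega
    rw [if_neg this.1, if_neg this.2.1, if_neg this.2.2]
    simpa using h4

end HamSystem

theorem ZMod.natCast_add_natCast_eq_zero {n i j : ℕ} (h : i + j = n) :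
    (i : ZMod n) + (j : ZMod n) = 0 := by
  rw [← Nat.cast_add, h, ZMod.natCast_self]

theorem ZMod.natCast_ne_zero_of_lt {n i : ℕ} (h0 : 0 < i) (hi : i < n) : (i : ZMod n) ≠ 0 := by
  have := ZMod.natCast_ne_of_lt h0 hi
  rw [Nat.cast_zero] at this
  exact this.symm

/-! ### Configurations of extra edges forbidden by a missing length. -/

namespace HamSystem

variable {n r : ℕ} (S : HamSystem n r)

/-- The edges outside the hamiltonian cycle. -/
def IsExtra (A : Finset (ZMod n)) : Prop := A ∈ S.E ∧ ∀ i, S.e i ≠ A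

theorem e_add_ne {a : ZMod n} {i j : ℕ} (hi : i < n) (hj : j < n) (hij : i ≠ j) :
    S.e (a + i) ≠ S.e (a + j) := fun h =>
  hij (ZMod.natCast_inj_of_lt hi hj (add_left_cancel (S.e_injective h)))

theorem cycle_of_arc (a : ZMod n) (t : ℕ) (ht : 1 ≤ t) (htn : t < n) {g : Finset (ZMod n)}
    (hg : g ∈ S.E) (hge : ∀ j : ℕ, j < t → S.e (a + j) ≠ g) (h1 : a ∈ g) (h2 : a + t ∈ g) :
    HasBergeCycle S.E (t + 1) := by
  have h0 : S.e (a + (0 : ℕ)) = S.e a := by simp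
  -- The first arc is the single vertex `a`, linked to the second one by the cycle edge `S.e a`
  -- itself.
  refine S.cycle_of_parallel_arcs a 0 1 t (by omega) ht htn (by omega) (S.e_mem a) hg
    (h0 ▸ hge 0 (by omega)) ?_ (fun j hj => hge j (by omega)) (by simpa using S.left_mem a)
    (by simpa using S.right_mem a) h2 h1
  intro j hj
  rw [← h0]
  exact S.e_add_ne (by omega) (by omega) (by omega)

/-- The path from `x` to `x + d` is broken after `x + j` and closed by two other edges. -/
theorem cycle_of_broken_arc {d : ℕ} (x : ZMod n) (j : ℕ) (hj : j < d) (hd : d < n)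
    {f g : Finset (ZMod n)} (hf : f ∈ S.E) (hg : g ∈ S.E) (hfg : f ≠ g)
    (hfe : ∀ i : ℕ, i < d → i ≠ j → S.e (x + i) ≠ f)
    (hge : ∀ i : ℕ, i < d → i ≠ j → S.e (x + i) ≠ g)
    (h1 : x + j ∈ f) (h2 : x + d ∈ f) (h3 : x + j + 1 ∈ g) (h4 : x ∈ g) :
    HasBergeCycle S.E (d + 1) :=
  S.cycle_of_crossed_arcs x j (j + 1) d (by omega) (by omega) hd (by omega) hf hg hfg
    (fun i hi => hfe i (by omega) (by omega)) (fun i hi => hge i (by omega) (by omega))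
    h1 h2 (by push_cast; rwa [← add_assoc]) h4

variable {S} {d e : ℕ}

theorem IsExtra.add_notMem {A : Finset (ZMod n)} (hA : S.IsExtra A) (hd : 1 ≤ d) (hdn : d < n)
    (hno : ¬ HasBergeCycle S.E (d + 1)) {x : ZMod n} (hx : x ∈ A) : x + d ∉ A := fun h =>
  hno (S.cycle_of_arc x d hd hdn hA.1 (fun _ _ => hA.2 _) hx h)

theorem IsExtra.not_broken {A B : Finset (ZMod n)} (hA : S.IsExtra A) (hB : S.IsExtra B)
    (hAB : A ≠ B) (hdn : d < n) (hno : ¬ HasBergeCycle S.E (d + 1)) {x : ZMod n} {j : ℕ}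
    (hj : j < d) (h1 : x ∈ A) (h2 : x + j + 1 ∈ A) (h3 : x + j ∈ B) (h4 : x + d ∈ B) : False :=
  hno (S.cycle_of_broken_arc x j hj hdn hB.1 hA.1 hAB.symm (fun _ _ _ => hB.2 _)
    (fun _ _ _ => hA.2 _) h3 h4 h2 h1)

/-- The arc of `d` vertices starting at `x` ends at `x - e - 1`. The outside vertex `x - j` is
attached to both of its ends by `A` and `B`, which gives length `d + 1`. -/
theorem IsExtra.not_triangle {A B : Finset (ZMod n)} (hA : S.IsExtra A) (hB : S.IsExtra B)
    (hAB : A ≠ B) (hd : 1 ≤ d) (hde : d + e = n) (hno : ¬ HasBergeCycle S.E (d + 1)) {x : ZMod n}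
    {j : ℕ} (hj1 : 1 ≤ j) (hj : j ≤ e) (hx : x ∈ A) (hy : x - e - 1 ∈ B) (h1 : x - j ∈ A)
    (h2 : x - j ∈ B) : False := by
  have e1 : x + ((d - 1 : ℕ) : ZMod n) = x - e - 1 := by
    have := ZMod.natCast_add_natCast_eq_zero (show (d - 1) + (e + 1) = n by omega)
    rw [Nat.cast_add e 1, Nat.cast_one] at this
    linear_combination this
  have e2 : x + ((n - j : ℕ) : ZMod n) = x - j := by
    have := ZMod.natCast_add_natCast_eq_zero (show (n - j) + j = n by omega)
    linear_combination this
  exact hno (S.cycle_of_parallel_arcs x (d - 1) (n - j) (n - j) (by omega) le_rfl (by omega)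
    (by omega) hB.1 hA.1 hAB.symm (fun _ _ => hB.2 _) (fun _ _ => hA.2 _) (e1 ▸ hy) (e2 ▸ h2)
    (e2 ▸ h1) hx)

/-- Two shortcuts on the hamiltonian cycle: `A` skips the `e - 2` vertices between `x` and `x + e -
1`, and `B` skips `x + 2e + 1`. Exactly `n - (e - 1) = d + 1` vertices remain. -/
theorem IsExtra.not_quad {A B : Finset (ZMod n)} (hA : S.IsExtra A) (hB : S.IsExtra B)
    (hAB : A ≠ B) (hde : d + e = n) (he : 2 ≤ e) (hn : 2 * e + 2 ≤ n)
    (hno : ¬ HasBergeCycle S.E (d + 1)) {x : ZMod n}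
    (h1 : x ∈ A) (h2 : x + e - 1 ∈ A) (h3 : x + e + e ∈ B) (h4 : x + e + e + 2 ∈ B) : False := by
  have e1 : x + e - 1 + ((n - e + 1 : ℕ) : ZMod n) = x := by
    have := ZMod.natCast_add_natCast_eq_zero (show (n - e) + e = n by omega)
    push_cast
    linear_combination this
  refine hno (S.cycle_of_parallel_arcs (x + e - 1) (e + 1) (e + 3) (n - e + 1) (by omega)
    (by omega) (by omega) (by omega) hB.1 hA.1 hAB.symm (fun _ _ => hB.2 _) (fun _ _ => hA.2 _)
    ?_ ?_ (e1.symm ▸ h1) h2)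
  · convert h3 using 1; push_cast; ring
  · convert h4 using 1; push_cast; ring

/-- Each nonzero `u ∈ U` excludes a vertex `φ u` from `S.e 0`. If `u` comes before `d`, the arc from
`u - d` to `u` passes through `0`; it is broken after `0` and closed by `A` and `S.e 0`. If `u`
comes after `d`, the arc from `u - d + 1` to `u` misses `0`, which is attached to its ends by the
same two edges. As `φ` is injective, `U.card - 1 + r ≤ n`. -/
theorem card_add_le_of_forall_mem_extra (hd : 1 ≤ d) (hde : d + e = n) (he : 2 ≤ e)
    (hno : ¬ HasBergeCycle S.E (d + 1)) {U : Finset (ZMod n)}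
    (hU : ∀ u ∈ U, ∃ A, S.IsExtra A ∧ u ∈ A ∧ 0 ∈ A) : U.card + r ≤ n + 1 := by
  have : NeZero n := ⟨by omega⟩
  have hcast := ZMod.natCast_add_natCast_eq_zero hde
  let φ : ZMod n → ZMod n := fun u => if u.val < d then u - d else u - d + 1
  have hne : ∀ u ∈ U, u.val ≠ d := by
    intro u hu h
    obtain ⟨A, hA, huA, h0⟩ := hU u hu
    refine hA.add_notMem hd (by omega) hno h0 ?_
    rw [zero_add, ← h, ZMod.natCast_zmod_val]
    exact huA
  have hφ : ∀ u ∈ U.erase 0, φ u ∉ S.e 0 := by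
    intro u hu hmem
    obtain ⟨hu0, hu⟩ := Finset.mem_erase.1 hu
    obtain ⟨A, hA, huA, h0⟩ := hU u hu
    have hlt := ZMod.val_lt u
    have hpos : 0 < u.val := Nat.pos_of_ne_zero (fun h => hu0 ((ZMod.val_eq_zero u).1 h))
    have hud := hne u hu
    have huv : ((u.val : ℕ) : ZMod n) = u := ZMod.natCast_zmod_val u
    generalize hq : u.val = q at *
    subst huv
    have hAe : S.e 0 ≠ A := hA.2 0
    by_cases h : q < d
    · have hφu : φ q = q - d := by simp only [φ, hq, if_pos h]
      rw [hφu] at hmem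
      have hp := ZMod.natCast_add_natCast_eq_zero (show (d - q) + (q + e) = n by omega)
      push_cast at hp
      have e0 : (q : ZMod n) - d + ((d - q : ℕ) : ZMod n) = 0 := by linear_combination hp - hcast
      refine hno (S.cycle_of_broken_arc ((q : ZMod n) - d) (d - q) (by omega) (by omega) hA.1
        (S.e_mem 0) hAe.symm (fun _ _ _ => hA.2 _) ?_ (e0.symm ▸ h0) (by simpa using huA) ?_ hmem)
      · intro i hi hij
        conv_rhs => rw [← e0]
        exact S.e_add_ne (by omega) (by omega) hij
      · rw [e0]; exact S.right_mem 0
    · have hφu : φ q = q - d + 1 := by simp only [φ, hq, if_neg h]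
      rw [hφu] at hmem
      have hs := ZMod.natCast_add_natCast_eq_zero (show (n - (q - d + 1)) + (q - d + 1) = n by omega)
      rw [Nat.cast_add (q - d), Nat.cast_sub (show d ≤ q by omega), Nat.cast_one] at hs
      have e0 : (q : ZMod n) - d + 1 + ((n - (q - d + 1) : ℕ) : ZMod n) = 0 := by
        linear_combination hs
      have hp : (((d - 1 : ℕ)) : ZMod n) = d - 1 := by
        rw [Nat.cast_sub hd, Nat.cast_one]
      refine hno (S.cycle_of_parallel_arcs ((q : ZMod n) - d + 1) (d - 1) (n - (q - d + 1))
        (n - (q - d + 1)) (by omega) le_rfl (by omega) (by omega) hA.1 (S.e_mem 0) hAe.symm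
        (fun _ _ => hA.2 _) ?_ ?_ (e0.symm ▸ h0) (e0.symm ▸ S.left_mem 0) hmem)
      · intro i hi
        conv_rhs => rw [← e0]
        exact S.e_add_ne (by omega) (by omega) (by omega)
      · rw [hp]
        convert huA using 1
        ring
  have hinj : Set.InjOn φ (U.erase 0 : Finset (ZMod n)) := by
    intro u hu u' hu' h
    obtain ⟨hu0, hu⟩ := Finset.mem_erase.1 (Finset.mem_coe.1 hu)
    obtain ⟨hu0', hu'⟩ := Finset.mem_erase.1 (Finset.mem_coe.1 hu')
    have hlt := ZMod.val_lt u
    have hlt' := ZMod.val_lt u'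
    have hpos : 0 < u.val := Nat.pos_of_ne_zero (fun h => hu0 ((ZMod.val_eq_zero u).1 h))
    have hpos' : 0 < u'.val := Nat.pos_of_ne_zero (fun h => hu0' ((ZMod.val_eq_zero u').1 h))
    have hud := hne u hu
    have hud' := hne u' hu'
    have huv : ((u.val : ℕ) : ZMod n) = u := ZMod.natCast_zmod_val u
    have huv' : ((u'.val : ℕ) : ZMod n) = u' := ZMod.natCast_zmod_val u'
    -- A collision between the two branches says that the smaller value is the larger one plus `1`.
    -- This happens only by wrapping round to `0`, which has been erased.
    simp only [φ] at h
    split_ifs at h with h1 h2 h2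
    · exact sub_left_injective h
    · exfalso
      have : ((u.val : ℕ) : ZMod n) = ((u'.val + 1 : ℕ) : ZMod n) := by
        push_cast; rw [huv, huv']; linear_combination h
      by_cases h3 : u'.val + 1 = n
      · rw [h3, ZMod.natCast_self] at this
        exact ZMod.natCast_ne_zero_of_lt hpos hlt this
      · have := ZMod.natCast_inj_of_lt hlt (by omega) this
        omega
    · exfalso
      have : ((u.val + 1 : ℕ) : ZMod n) = ((u'.val : ℕ) : ZMod n) := by
        push_cast; rw [huv, huv']; linear_combination h
      by_cases h3 : u.val + 1 = n
      · rw [h3, ZMod.natCast_self] at this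
        exact ZMod.natCast_ne_zero_of_lt hpos' hlt' this.symm
      · have := ZMod.natCast_inj_of_lt (by omega) hlt' this
        omega
    · linear_combination h
  have hdisj : Disjoint ((U.erase 0).image φ) (S.e 0) := by
    rw [Finset.disjoint_left]
    intro z hz
    obtain ⟨u, hu, rfl⟩ := Finset.mem_image.1 hz
    exact hφ u hu
  have h1 := Finset.card_le_univ ((U.erase 0).image φ ∪ S.e 0)
  rw [Finset.card_union_of_disjoint hdisj, Finset.card_image_of_injOn hinj, ZMod.card,
    S.card_eq _ (S.e_mem 0)] at h1
  have h2 := Finset.pred_card_le_card_erase (s := U) (a := 0)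
  omega

end HamSystem

/-! ### One extra edge when `n ≤ 2 * r`. -/

theorem ZMod.two_mul_card_le_of_add_notMem {n : ℕ} [NeZero n] {A : Finset (ZMod n)} {c : ZMod n}
    (hA : ∀ x ∈ A, x + c ∉ A) : 2 * A.card ≤ n := by
  have hdisj : Disjoint A (A.image (· + c)) := by
    rw [Finset.disjoint_right]
    intro z hz
    obtain ⟨u, hu, rfl⟩ := Finset.mem_image.1 hz
    exact hA u hu
  have h1 := Finset.card_le_univ (A ∪ A.image (· + c))
  rw [Finset.card_union_of_disjoint hdisj, Finset.card_image_of_injective _ (add_left_injective c),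
    ZMod.card] at h1
  omega

theorem ZMod.add_mem_iff_of_add_notMem {n : ℕ} [NeZero n] {A : Finset (ZMod n)} {c : ZMod n}
    (hA : ∀ x ∈ A, x + c ∉ A) (hcard : 2 * A.card = n) (x : ZMod n) : x + c ∈ A ↔ x ∉ A := by
  have hdisj : Disjoint A (A.image (· + c)) := by
    rw [Finset.disjoint_right]
    intro z hz
    obtain ⟨u, hu, rfl⟩ := Finset.mem_image.1 hz
    exact hA u hu
  have h1 : A ∪ A.image (· + c) = Finset.univ := by
    apply Finset.eq_univ_of_card
    rw [Finset.card_union_of_disjoint hdisj,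
      Finset.card_image_of_injective _ (add_left_injective c), ZMod.card]
    omega
  constructor
  · intro h h'
    exact hA x h' h
  · intro h
    by_contra h'
    have h2 : x + c ∈ A ∪ A.image (· + c) := h1 ▸ Finset.mem_univ _
    rcases Finset.mem_union.1 h2 with h3 | h3
    · exact h' h3
    · obtain ⟨u, hu, hux⟩ := Finset.mem_image.1 h3
      exact h (add_right_cancel hux ▸ hu)

theorem ZMod.exists_natCast_eq_sub {n : ℕ} [NeZero n] (x y : ZMod n) :
    ∃ q : ℕ, q < n ∧ y = x + q :=
  ⟨(y - x).val, ZMod.val_lt _, by rw [ZMod.natCast_zmod_val]; ring⟩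

namespace HamSystem

variable {n r : ℕ} {S : HamSystem n r} {d e : ℕ}

/-- With `i` and `i + 1` in `A`, the edge `A` can stand in for `B = S.e i` on the cycle, so `B` is
also complementary to its translate by `d`. Broken arcs closed by `A` and `B` show that the two
agree on `d` consecutive positions; translation by `d` spreads this to all of `ZMod n`. -/
theorem IsExtra.not_consecutive_of_two_mul_eq {A : Finset (ZMod n)} (hA : S.IsExtra A)
    (hn : n = 2 * r) (hd : 1 ≤ d) (hdn : d < n) (hno : ¬ HasBergeCycle S.E (d + 1)) {i : ZMod n}
    (hi : i ∈ A) (hi1 : i + 1 ∈ A) : False := by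
  have : NeZero n := ⟨by omega⟩
  set B := S.e i with hB
  have hBA : B ≠ A := hA.2 i
  have hT0 : ∀ x ∈ A, x + d ∉ A := fun x hx => hA.add_notMem hd hdn hno hx
  have hAiff := ZMod.add_mem_iff_of_add_notMem hT0 (by rw [S.card_eq A hA.1, hn])
  have hT0' : ∀ x ∈ B, x + d ∉ B := by
    intro x hx hxd
    obtain ⟨q, hq, rfl⟩ := ZMod.exists_natCast_eq_sub x i
    by_cases hqd : q < d
    -- The arc uses `S.e i`; there `A` replaces it, leaving `B` free to close the cycle.
    · exact hno (S.cycle_of_parallel_arcs x q (q + 1) d (by omega) (by omega) hdn (by omega) hA.1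
        (S.e_mem _) hBA.symm (fun _ _ => hA.2 _)
        (fun j hj => S.e_add_ne (by omega) (by omega) (by omega)) hi
        (by push_cast; rwa [← add_assoc]) hxd hx)
    · exact hno (S.cycle_of_arc x d hd hdn (S.e_mem _)
        (fun j hj => S.e_add_ne (by omega) (by omega) (by omega)) hx hxd)
  have hBiff := ZMod.add_mem_iff_of_add_notMem hT0' (by rw [S.card_eq B (S.e_mem _), hn])
  have key : ∀ j : ℕ, j < d → (i - j ∈ A ↔ i - j ∈ B) := by
    intro j hj
    set x := i - (j : ZMod n) with hx
    have hxi : x + j = i := by rw [hx]; ring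
    have hBe : ∀ l : ℕ, l < d → l ≠ j → S.e (x + l) ≠ B := by
      intro l hl hlj
      rw [hB, ← hxi]
      exact S.e_add_ne (by omega) (by omega) hlj
    constructor
    · intro h
      by_contra h'
      exact hno (S.cycle_of_broken_arc x j hj hdn (S.e_mem i) hA.1 hBA hBe
        (fun _ _ _ => hA.2 _) (hxi ▸ S.left_mem i) ((hBiff x).2 h') (hxi.symm ▸ hi1) h)
    · intro h
      by_contra h'
      exact hno (S.cycle_of_broken_arc x j hj hdn hA.1 (S.e_mem i) hBA.symm
        (fun _ _ _ => hA.2 _) hBe (hxi.symm ▸ hi) ((hAiff x).2 h') (hxi ▸ S.right_mem i) h)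
  have all : ∀ q : ℕ, (i + q + 1 - d ∈ A ↔ i + q + 1 - d ∈ B) := by
    intro q
    induction q using Nat.strong_induction_on with
    | _ q ih =>
      by_cases hq : q < d
      · have h1 := key (d - 1 - q) (by omega)
        have h2 : i - ((d - 1 - q : ℕ) : ZMod n) = i + q + 1 - d := by
          rw [Nat.cast_sub (by omega), Nat.cast_sub hd]; push_cast; ring
        rwa [h2] at h1
      · have h1 := ih (q - d) (by omega)
        have h2 : i + ((q - d : ℕ) : ZMod n) + 1 - d = i + q + 1 - d - d := by
          rw [Nat.cast_sub (by omega)]; ring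
        rw [h2] at h1
        have h3 := hAiff (i + q + 1 - d - d)
        have h4 := hBiff (i + q + 1 - d - d)
        rw [sub_add_cancel] at h3 h4
        rw [h3, h4, h1]
  apply hBA
  ext z
  obtain ⟨q, -, hq⟩ := ZMod.exists_natCast_eq_sub (i + 1 - (d : ZMod n)) z
  have h1 := all q
  have h2 : i + q + 1 - d = z := by rw [hq]; ring
  rw [h2] at h1
  exact h1.symm

/-- Two edges sharing two vertices form a Berge cycle of length `2`. -/
theorem cycle_two_of_mem (S : HamSystem n r) {f g : Finset (ZMod n)} (hf : f ∈ S.E) (hg : g ∈ S.E)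
    (hfg : f ≠ g) [NeZero n] {x y : ZMod n} (hxy : x ≠ y) (h1 : x ∈ f) (h2 : y ∈ f) (h3 : x ∈ g)
    (h4 : y ∈ g) : HasBergeCycle S.E 2 := by
  obtain ⟨q, hq, rfl⟩ := ZMod.exists_natCast_eq_sub x y
  have hq0 : 0 < q := Nat.pos_of_ne_zero (by rintro rfl; simp at hxy)
  exact S.cycle_of_parallel_arcs x 0 q q hq0 le_rfl hq (by omega) hf hg hfg (by intro j hj; omega)
    (by intro j hj; omega) (by simpa using h1) h2 h4 h3

/-- Each cycle edge meets `A` at most once, so it contains all but at most one vertex of the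
`r`-element complement of `A`. There are `2 * r` cycle edges, so two of them may be taken to omit
the same vertex; they share at least `r - 1 ≥ 2` vertices. -/
theorem IsExtra.cycle_two_of_two_mul_eq {A : Finset (ZMod n)} (hA : S.IsExtra A) (hr3 : 3 ≤ r)
    (hn : n = 2 * r) : HasBergeCycle S.E 2 := by
  have : NeZero n := ⟨by omega⟩
  by_contra hno
  have hcomp : (Aᶜ).card = r := by
    rw [Finset.card_compl, ZMod.card, S.card_eq A hA.1]; omega
  have hsub : ∀ i, (S.e i ∩ A).card ≤ 1 := by
    intro i
    rw [Finset.card_le_one]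
    intro x hx y hy
    by_contra hxy
    rw [Finset.mem_inter] at hx hy
    exact hno (S.cycle_two_of_mem (S.e_mem i) hA.1 (hA.2 i) hxy hx.1 hy.1 hx.2 hy.2)
  have hodd : ∀ i, ∃ m ∈ Aᶜ, Aᶜ.erase m ⊆ S.e i := by
    intro i
    have h1 := Finset.card_sdiff_add_card_inter (S.e i) A
    rw [S.card_eq _ (S.e_mem i)] at h1
    have h2 := hsub i
    have h3 : S.e i \ A ⊆ Aᶜ := by
      intro z hz
      rw [Finset.mem_compl]
      exact (Finset.mem_sdiff.1 hz).2
    have h4 : (Aᶜ \ (S.e i \ A)).card ≤ 1 := by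
      rw [Finset.card_sdiff_of_subset h3]; omega
    rw [Finset.card_le_one] at h4
    by_cases h5 : ∃ m, m ∈ Aᶜ \ (S.e i \ A)
    · obtain ⟨m, hm⟩ := h5
      refine ⟨m, (Finset.mem_sdiff.1 hm).1, ?_⟩
      intro z hz
      rw [Finset.mem_erase] at hz
      by_contra hz'
      exact hz.1 (h4 z (Finset.mem_sdiff.2 ⟨hz.2, fun h => hz' (Finset.mem_sdiff.1 h).1⟩) m hm)
    · push Not at h5
      obtain ⟨m, hm⟩ : (Aᶜ).Nonempty := Finset.card_pos.1 (by omega)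
      refine ⟨m, hm, ?_⟩
      intro z hz
      by_contra hz'
      exact h5 z (Finset.mem_sdiff.2 ⟨(Finset.mem_erase.1 hz).2,
        fun h => hz' (Finset.mem_sdiff.1 h).1⟩)
  choose m hm hms using hodd
  obtain ⟨i, -, j, -, hij, hmij⟩ := Finset.exists_ne_map_eq_of_card_lt_of_maps_to
    (s := (Finset.univ : Finset (ZMod n))) (t := Aᶜ) (f := m)
    (by rw [hcomp, Finset.card_univ, ZMod.card]; omega) (fun i _ => hm i)
  have h2 : 1 < (Aᶜ.erase (m i)).card := by
    rw [Finset.card_erase_of_mem (hm i)]; omega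
  obtain ⟨x, hx, y, hy, hxy⟩ := Finset.one_lt_card.1 h2
  exact hno (S.cycle_two_of_mem (S.e_mem i) (S.e_mem j) (fun h => hij (S.e_injective h)) hxy
    (hms i hx) (hms i hy) (hms j (hmij ▸ hx)) (hms j (hmij ▸ hy)))

theorem alternating_add_mem_iff {n : ℕ} {A : Finset (ZMod n)} (hA1 : ∀ x, x + 1 ∈ A ↔ x ∉ A)
    (x : ZMod n) (q : ℕ) : x + q ∈ A ↔ (x ∈ A ↔ q % 2 = 0) := by
  induction q with
  | zero => simp
  | succ q ih =>
    rw [Nat.cast_succ, ← add_assoc, hA1, ih]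
    rcases Nat.mod_two_eq_zero_or_one q with h | h
    · have : (q + 1) % 2 = 1 := by omega
      simp [h, this]
    · have : (q + 1) % 2 = 0 := by omega
      simp [h, this]

/-- For `a ∈ A`, the edge `S.e a` has a third vertex `a + q`. Two arcs that avoid the step from `a`
to `a + 1` are linked by `S.e a` and by `A`, which contains every `a + q'` with `q'` even. Sliding
the ends in `A` by two reaches every even length. -/
theorem IsExtra.cycle_of_alternating {A : Finset (ZMod n)} (hA : S.IsExtra A) (hr3 : 3 ≤ r)
    (hn : n = 2 * r) (hA1 : ∀ x, x + 1 ∈ A ↔ x ∉ A) {k : ℕ} (hk2 : 3 ≤ k) (hkn : k < n)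
    (hk : k % 2 = 0) : HasBergeCycle S.E k := by
  have : NeZero n := ⟨by omega⟩
  obtain ⟨a, ha⟩ : A.Nonempty := Finset.card_pos.1 (by rw [S.card_eq A hA.1]; omega)
  have hmem : ∀ q : ℕ, q % 2 = 0 → a + q ∈ A := fun q hq =>
    (alternating_add_mem_iff hA1 a q).2 (by simp [ha, hq])
  obtain ⟨x, hx, hxa⟩ : ∃ x ∈ S.e a, x ∉ ({a, a + 1} : Finset (ZMod n)) := by
    apply Finset.exists_mem_notMem_of_card_lt_card
    rw [S.card_eq _ (S.e_mem a)]
    exact lt_of_le_of_lt Finset.card_le_two (by omega)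
  obtain ⟨q, hq, rfl⟩ := ZMod.exists_natCast_eq_sub a x
  have hq2 : 2 ≤ q := by
    by_contra h
    have : q = 0 ∨ q = 1 := by omega
    rcases this with rfl | rfl <;> simp at hxa
  have ea : ∀ j : ℕ, 0 < j → j < n → S.e (a + j) ≠ S.e a := by
    intro j h0 hj
    have := S.e_add_ne (a := a) (i := j) (j := 0) hj (by omega) (by omega)
    simpa using this
  by_cases hqe : q % 2 = 0
  · -- arcs `[u, q]` and `[w, n]`
    obtain ⟨u, w, hu, huq, hw, hwn, hu2, hw2, huw⟩ : ∃ u w : ℕ, 2 ≤ u ∧ u ≤ q ∧ q < w ∧ w ≤ n ∧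
        u % 2 = 0 ∧ w % 2 = 0 ∧ k = (q - u + 1) + (n - w + 1) := by
      by_cases h : k ≤ q
      · exact ⟨q - (k - 2), n, by omega, by omega, by omega, by omega, by omega, by omega,
          by omega⟩
      · exact ⟨2, n - (k - q), by omega, by omega, by omega, by omega, by omega, by omega,
          by omega⟩
    have e1 : a + u + ((q - u : ℕ) : ZMod n) = a + q := by
      rw [Nat.cast_sub huq]; ring
    have e2 : a + u + ((w - u : ℕ) : ZMod n) = a + w := by
      rw [Nat.cast_sub (by omega)]; ring
    have e3 : a + u + ((n - u : ℕ) : ZMod n) = a := by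
      rw [Nat.cast_sub (by omega), ZMod.natCast_self]; ring
    refine S.cycle_of_crossed_arcs (a + u) (q - u) (w - u) (n - u) (by omega) (by omega) (by omega)
      (by omega) (S.e_mem a) hA.1 (hA.2 a) ?_ (fun _ _ => hA.2 _) (e1 ▸ hx)
      (e3.symm ▸ S.left_mem a) (e2 ▸ hmem w hw2) (hmem u hu2)
    intro j hj
    rw [add_assoc, ← Nat.cast_add]
    exact ea _ (by omega) (by omega)
  · -- arcs `[1, u]` and `[q, w]`
    obtain ⟨u, w, hu, huq, hw, hwn, hu2, hw2, huw⟩ : ∃ u w : ℕ, 2 ≤ u ∧ u < q ∧ q < w ∧ w ≤ n ∧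
        u % 2 = 0 ∧ w % 2 = 0 ∧ k = u + (w - q + 1) := by
      by_cases h : k ≤ q
      · exact ⟨k - 2, q + 1, by omega, by omega, by omega, by omega, by omega, by omega,
          by omega⟩
      · exact ⟨q - 1, k, by omega, by omega, by omega, by omega, by omega, by omega,
          by omega⟩
    have e1 : a + 1 + ((u - 1 : ℕ) : ZMod n) = a + u := by
      rw [Nat.cast_sub (by omega), Nat.cast_one]; ring
    have e2 : a + 1 + ((q - 1 : ℕ) : ZMod n) = a + q := by
      rw [Nat.cast_sub (by omega), Nat.cast_one]; ring
    have e3 : a + 1 + ((w - 1 : ℕ) : ZMod n) = a + w := by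
      rw [Nat.cast_sub (by omega), Nat.cast_one]; ring
    refine S.cycle_of_crossed_arcs (a + 1) (u - 1) (q - 1) (w - 1) (by omega) (by omega) (by omega)
      (by omega) hA.1 (S.e_mem a) (hA.2 a).symm (fun _ _ => hA.2 _) ?_ (e1 ▸ hmem u hu2)
      (e3 ▸ hmem w hw2) (e2 ▸ hx) (S.right_mem a)
    intro j hj
    have : a + 1 + (j : ZMod n) = a + ((j + 1 : ℕ) : ZMod n) := by push_cast; ring
    rw [this]
    exact ea _ (by omega) (by omega)

theorem IsExtra.hasBergeCycle_of_le_two_mul {A : Finset (ZMod n)} (hA : S.IsExtra A) (hr3 : 3 ≤ r)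
    (hn : n ≤ 2 * r) {k : ℕ} (hk2 : 2 ≤ k) (hkn : k < n) : HasBergeCycle S.E k := by
  have : NeZero n := ⟨by omega⟩
  by_contra hno
  obtain ⟨d, rfl⟩ : ∃ d, k = d + 1 := ⟨k - 1, by omega⟩
  have hT0 : ∀ x ∈ A, x + d ∉ A := fun x hx => hA.add_notMem (by omega) (by omega) hno hx
  have hn2 : n = 2 * r := by
    have := ZMod.two_mul_card_le_of_add_notMem hT0
    rw [S.card_eq A hA.1] at this
    omega
  have hA1 : ∀ x, x + 1 ∈ A ↔ x ∉ A := ZMod.add_mem_iff_of_add_notMem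
    (fun x hx hx1 => hA.not_consecutive_of_two_mul_eq hn2 (by omega) (by omega) hno hx hx1)
    (by rw [S.card_eq A hA.1, hn2])
  by_cases hd : d = 1
  · subst hd
    exact hno (hA.cycle_two_of_two_mul_eq hr3 hn2)
  · refine hno (hA.cycle_of_alternating hr3 hn2 hA1 (by omega) hkn ?_)
    obtain ⟨a, ha⟩ : A.Nonempty := Finset.card_pos.1 (by rw [S.card_eq A hA.1]; omega)
    have h1 := hT0 a ha
    rw [alternating_add_mem_iff hA1] at h1
    -- An even `d` would put `a + d` into `A`, so the missing length `d + 1` is even.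
    have : d % 2 ≠ 0 := fun h => h1 (by simp [ha, h])
    omega

end HamSystem

/-! ### Three extra edges inside a set of `r + 1` vertices. -/

theorem ZMod.exists_mem_sub_one_notMem {n : ℕ} [NeZero n] {D : Finset (ZMod n)} {a b : ZMod n}
    (ha : a ∈ D) (hb : b ∉ D) : ∃ x ∈ D, x - 1 ∉ D := by
  by_contra! h
  have key : ∀ q : ℕ, a - q ∈ D := by
    intro q
    induction q with
    | zero => simpa using ha
    | succ q ih =>
      have := h _ ih
      rwa [sub_sub, ← Nat.cast_succ] at this
  obtain ⟨q, -, hq⟩ := ZMod.exists_natCast_eq_sub b a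
  have := key q
  rw [hq, add_sub_cancel_right] at this
  exact hb this

namespace HamSystem

variable {n r : ℕ} {S : HamSystem n r} {d e : ℕ}

/-- Three extra edges arise from the `r + 1`-element set `D` by deleting one element. -/
structure IsSunflower (S : HamSystem n r) (D : Finset (ZMod n)) (t₁ t₂ t₃ : ZMod n) : Prop where
  card_eq : D.card = r + 1
  mem₁ : t₁ ∈ D
  mem₂ : t₂ ∈ D
  mem₃ : t₃ ∈ D
  ne₁₂ : t₁ ≠ t₂
  ne₁₃ : t₁ ≠ t₃
  ne₂₃ : t₂ ≠ t₃
  extra₁ : S.IsExtra (D.erase t₁)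
  extra₂ : S.IsExtra (D.erase t₂)
  extra₃ : S.IsExtra (D.erase t₃)

namespace IsSunflower

variable {D : Finset (ZMod n)} {t₁ t₂ t₃ : ZMod n}

/-- Two vertices rule out at most two of the three deletions. -/
theorem exists_extra (h : S.IsSunflower D t₁ t₂ t₃) {x y : ZMod n} (hx : x ∈ D) (hy : y ∈ D) :
    ∃ A, S.IsExtra A ∧ x ∈ A ∧ y ∈ A := by
  obtain ⟨-, -, -, -, h12, h13, h23, e1, e2, e3⟩ := h
  by_cases c1 : x ≠ t₁ ∧ y ≠ t₁
  · exact ⟨_, e1, Finset.mem_erase.2 ⟨c1.1, hx⟩, Finset.mem_erase.2 ⟨c1.2, hy⟩⟩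
  by_cases c2 : x ≠ t₂ ∧ y ≠ t₂
  · exact ⟨_, e2, Finset.mem_erase.2 ⟨c2.1, hx⟩, Finset.mem_erase.2 ⟨c2.2, hy⟩⟩
  have c3 : x ≠ t₃ ∧ y ≠ t₃ := by grind
  exact ⟨_, e3, Finset.mem_erase.2 ⟨c3.1, hx⟩, Finset.mem_erase.2 ⟨c3.2, hy⟩⟩

/-- Failure means that for all `t ≠ t'` among the three deleted vertices, `t ∈ {x, y}` or `t' ∈ {z,
w}`. Some deleted vertex is not in `{x, y}`, so the other two make up `{z, w}`; a second one outside
`{x, y}` would put all three into `{z, w}`. Hence the two pairs coincide. -/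
theorem exists_two_extra (h : S.IsSunflower D t₁ t₂ t₃) {x y z w : ZMod n} (hx : x ∈ D)
    (hy : y ∈ D) (hz : z ∈ D) (hw : w ∈ D) (hne : ¬ (x = z ∧ y = w)) (hne' : ¬ (x = w ∧ y = z)) :
    ∃ A B, S.IsExtra A ∧ S.IsExtra B ∧ A ≠ B ∧ x ∈ A ∧ y ∈ A ∧ z ∈ B ∧ w ∈ B := by
  obtain ⟨-, m1, m2, m3, h12, h13, h23, e1, e2, e3⟩ := h
  have key : ∀ t t', t ∈ D → t ≠ t' → S.IsExtra (D.erase t) → S.IsExtra (D.erase t') →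
      (∃ A B, S.IsExtra A ∧ S.IsExtra B ∧ A ≠ B ∧ x ∈ A ∧ y ∈ A ∧ z ∈ B ∧ w ∈ B) ∨
      (x = t ∨ y = t ∨ z = t' ∨ w = t') := by
    intro t t' ht htt' et et'
    by_contra hc
    rw [not_or] at hc
    obtain ⟨hc, hc'⟩ := hc
    push Not at hc'
    obtain ⟨c1, c2, c3, c4⟩ := hc'
    apply hc
    refine ⟨_, _, et, et', ?_, Finset.mem_erase.2 ⟨c1, hx⟩, Finset.mem_erase.2 ⟨c2, hy⟩,
      Finset.mem_erase.2 ⟨c3, hz⟩, Finset.mem_erase.2 ⟨c4, hw⟩⟩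
    intro heq
    have : t ∈ D.erase t' := Finset.mem_erase.2 ⟨htt', ht⟩
    rw [← heq] at this
    exact (Finset.mem_erase.1 this).1 rfl
  by_contra hno
  have k12 := (key t₁ t₂ m1 h12 e1 e2).resolve_left hno
  have k21 := (key t₂ t₁ m2 h12.symm e2 e1).resolve_left hno
  have k13 := (key t₁ t₃ m1 h13 e1 e3).resolve_left hno
  have k31 := (key t₃ t₁ m3 h13.symm e3 e1).resolve_left hno
  have k23 := (key t₂ t₃ m2 h23 e2 e3).resolve_left hno
  have k32 := (key t₃ t₂ m3 h23.symm e3 e2).resolve_left hno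
  clear hno key e1 e2 e3 m1 m2 m3 hx hy hz hw
  grind (splits := 30)

theorem add_notMem (h : S.IsSunflower D t₁ t₂ t₃) (hd : 1 ≤ d) (hdn : d < n)
    (hno : ¬ HasBergeCycle S.E (d + 1)) {x : ZMod n} (hx : x ∈ D) : x + d ∉ D := by
  intro hxd
  obtain ⟨A, hA, h1, h2⟩ := h.exists_extra hx hxd
  exact hA.add_notMem hd hdn hno h1 h2

theorem two_mul_le (h : S.IsSunflower D t₁ t₂ t₃) (hd : 1 ≤ d) (hdn : d < n)
    (hno : ¬ HasBergeCycle S.E (d + 1)) : 2 * r + 2 ≤ n := by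
  have : NeZero n := ⟨by omega⟩
  have := ZMod.two_mul_card_le_of_add_notMem (fun x hx => h.add_notMem hd hdn hno (x := x) hx)
  rw [h.card_eq] at this
  omega

/-- Here the length is `n - 1`, so one vertex is left out. With `i = x - 2` and `z` a third vertex
of `S.e i`, one of `z + 1` and `z - 1` is in `D`. In the first case `i + 1` is omitted, in the
second `i`; two arcs are linked by `S.e i` and an extra edge. -/
theorem hasBergeCycle_of_eq_add_two (h : S.IsSunflower D t₁ t₂ t₃) (hr3 : 3 ≤ r)
    {x : ZMod n} (hx : x ∈ D) (hx1 : x - 1 ∉ D) (hx2 : x - 2 ∉ D) (hd : d + 2 = n)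
    (hD : ∀ z, z + 2 ∈ D ↔ z ∉ D) : HasBergeCycle S.E (d + 1) := by
  have hn : 4 ≤ n := by
    have : NeZero n := ⟨by omega⟩
    have := Finset.card_le_univ D
    rw [h.card_eq, ZMod.card] at this
    omega
  have : NeZero n := ⟨by omega⟩
  obtain ⟨i, rfl⟩ : ∃ i, x = i + 2 := ⟨x - 2, by ring⟩
  have hi : i - 1 ∈ D := by
    have h1 := hD (i - 1)
    have h2 : i - 1 + 2 = i + 2 - 1 := by ring
    rw [h2] at h1
    by_contra h3
    exact hx1 (h1.2 h3)
  obtain ⟨z, hz, hzi⟩ : ∃ z ∈ S.e i, z ∉ ({i, i + 1} : Finset (ZMod n)) := by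
    apply Finset.exists_mem_notMem_of_card_lt_card
    rw [S.card_eq _ (S.e_mem i)]
    exact lt_of_le_of_lt Finset.card_le_two (by omega)
  obtain ⟨q, hq, rfl⟩ := ZMod.exists_natCast_eq_sub i z
  have hq2 : 2 ≤ q := by
    by_contra h
    have : q = 0 ∨ q = 1 := by omega
    rcases this with rfl | rfl <;> simp at hzi
  have ei : ∀ j : ℕ, 0 < j → j < n → S.e (i + j) ≠ S.e i := by
    intro j h0 hj
    have := S.e_add_ne (a := i) (i := j) (j := 0) hj (by omega) (by omega)
    simpa using this
  have hn0 : ((n - 2 : ℕ) : ZMod n) = -2 := by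
    rw [Nat.cast_sub (by omega), ZMod.natCast_self]; push_cast; ring
  have hq0 : ((q - 2 : ℕ) : ZMod n) = q - 2 := by
    rw [Nat.cast_sub (by omega)]; push_cast; ring
  have hq1 : ((q - 1 : ℕ) : ZMod n) = q - 1 := by
    rw [Nat.cast_sub (by omega)]; push_cast; ring
  by_cases hz1 : i + q + 1 ∈ D
  · obtain ⟨A, hA, h1, h2⟩ := h.exists_extra hz1 hx
    refine S.cycle_of_crossed_arcs (i + 2) (q - 2) (q - 1) (n - 2) (by omega) (by omega) (by omega)
      (by omega) (S.e_mem i) hA.1 (hA.2 i) ?_ (fun _ _ => hA.2 _) ?_ ?_ ?_ h2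
    · intro j hj
      have : i + 2 + (j : ZMod n) = i + ((j + 2 : ℕ) : ZMod n) := by push_cast; ring
      rw [this]
      exact ei _ (by omega) (by omega)
    · convert hz using 1; rw [hq0]; ring
    · convert S.left_mem i using 1; rw [hn0]; ring
    · convert h1 using 1; rw [hq1]; ring
  · have hz2 : i + q - 1 ∈ D := by
      have h1 := hD (i + q - 1)
      have h2 : i + (q : ZMod n) - 1 + 2 = i + q + 1 := by ring
      rw [h2] at h1
      by_contra h3
      exact hz1 (h1.2 h3)
    obtain ⟨A, hA, h1, h2⟩ := h.exists_extra hz2 hi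
    refine S.cycle_of_crossed_arcs (i + 1) (q - 2) (q - 1) (n - 2) (by omega) (by omega) (by omega)
      (by omega) hA.1 (S.e_mem i) (hA.2 i).symm (fun _ _ => hA.2 _) ?_ ?_ ?_ ?_ (S.right_mem i)
    · intro j hj
      have : i + 1 + (j : ZMod n) = i + ((j + 1 : ℕ) : ZMod n) := by push_cast; ring
      rw [this]
      exact ei _ (by omega) (by omega)
    · convert h1 using 1; rw [hq0]; ring
    · convert h2 using 1; rw [hn0]; ring
    · convert hz using 1; rw [hq1]; ring

/-- The cycle edge `S.e i` at `i = x + e`, just past the run, has a third vertex `z = x + q`. If `q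
= 0`, it closes the arc from `x` to `i`. If `z` is in the run, `z` is attached to the arc from `i +
1` round to `x`. Otherwise the arc from `z` to `x` continues by an extra edge to a vertex of the run
chosen to give the right length, and then on to `i`. -/
theorem hasBergeCycle_of_arc (h : S.IsSunflower D t₁ t₂ t₃) (hr3 : 3 ≤ r) (hn : n = 2 * e)
    (he : 3 ≤ e) {x : ZMod n} (hD : ∀ j : ℕ, j < e → x + j ∈ D) : HasBergeCycle S.E (e + 1) := by
  have : NeZero n := ⟨by omega⟩
  have hx : x ∈ D := by simpa using hD 0 (by omega)
  set i := x + (e : ZMod n) with hi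
  obtain ⟨z, hz, hzi⟩ : ∃ z ∈ S.e i, z ∉ ({i, i + 1} : Finset (ZMod n)) := by
    apply Finset.exists_mem_notMem_of_card_lt_card
    rw [S.card_eq _ (S.e_mem i)]
    exact lt_of_le_of_lt Finset.card_le_two (by omega)
  obtain ⟨q, hq, rfl⟩ := ZMod.exists_natCast_eq_sub x z
  have hqe : q ≠ e ∧ q ≠ e + 1 := by
    constructor
    · rintro rfl
      simp [hi] at hzi
    · rintro rfl
      apply hzi
      rw [hi]
      push_cast
      rw [← add_assoc]
      simp
  have ei : ∀ j : ℕ, j < n → j ≠ e → S.e (x + j) ≠ S.e i := fun j hj hje =>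
    S.e_add_ne hj (by omega) hje
  have hee : (e : ZMod n) + e = 0 := ZMod.natCast_add_natCast_eq_zero (by omega)
  rcases Nat.eq_zero_or_pos q with rfl | hq0
  · exact S.cycle_of_arc x e (by omega) (by omega) (S.e_mem i)
      (fun j hj => ei j (by omega) (by omega)) (by simpa using hz) (S.left_mem i)
  by_cases hq1 : q < e
  · obtain ⟨A, hA, h1, h2⟩ := h.exists_extra hx (hD q hq1)
    have e1 : ((e - 1 : ℕ) : ZMod n) = e - 1 := by
      rw [Nat.cast_sub (by omega)]; push_cast; ring
    have e2 : ((q + e - 1 : ℕ) : ZMod n) = q + e - 1 := by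
      rw [Nat.cast_sub (by omega)]; push_cast; ring
    refine S.cycle_of_parallel_arcs (i + 1) (e - 1) (q + e - 1) (q + e - 1) (by omega) le_rfl
      (by omega) (by omega) hA.1 (S.e_mem i) (hA.2 i).symm (fun _ _ => hA.2 _) ?_ ?_ ?_ ?_
      (S.right_mem i)
    · intro j hj
      have : i + 1 + (j : ZMod n) = x + ((e + 1 + j : ℕ) : ZMod n) := by push_cast; rw [hi]; ring
      rw [this]
      exact ei _ (by omega) (by omega)
    · convert h1 using 1; rw [e1, hi]; linear_combination hee
    · convert h2 using 1; rw [e2, hi]; linear_combination hee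
    · convert hz using 1; rw [e2, hi]; linear_combination hee
  · obtain ⟨A, hA, h1, h2⟩ := h.exists_extra hx (hD (2 * e + 1 - q) (by omega))
    have e1 : ((2 * e - q : ℕ) : ZMod n) = e + e - q := by
      rw [Nat.cast_sub (by omega)]; push_cast; ring
    have e2 : ((4 * e + 1 - 2 * q : ℕ) : ZMod n) = (e + e) + (e + e) + 1 - 2 * q := by
      rw [Nat.cast_sub (by omega)]; push_cast; ring
    have e3 : ((2 * e + 1 - q : ℕ) : ZMod n) = e + e + 1 - q := by
      rw [Nat.cast_sub (by omega)]; push_cast; ring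
    have e4 : ((3 * e - q : ℕ) : ZMod n) = e + (e + e) - q := by
      rw [Nat.cast_sub (by omega)]; push_cast; ring
    refine S.cycle_of_parallel_arcs (x + q) (2 * e - q) (4 * e + 1 - 2 * q) (3 * e - q) (by omega)
      (by omega) (by omega) (by omega) hA.1 (S.e_mem i) (hA.2 i).symm (fun _ _ => hA.2 _) ?_ ?_ ?_
      ?_ hz
    · intro j hj
      rcases hj with hj | hj
      · have : x + (q : ZMod n) + (j : ZMod n) = x + ((q + j : ℕ) : ZMod n) := by push_cast; ring
        rw [this]
        exact ei _ (by omega) (by omega)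
      · have : x + (q : ZMod n) + (j : ZMod n) = x + ((q + j - 2 * e : ℕ) : ZMod n) := by
          rw [Nat.cast_sub (by omega)]; push_cast; linear_combination hee
        rw [this]
        exact ei _ (by omega) (by omega)
    · convert h1 using 1; rw [e1]; linear_combination hee
    · convert h2 using 1; rw [e2, e3]; linear_combination hee
    · convert S.left_mem i using 1; rw [e4, hi]; linear_combination hee

/-- Equality in the counting makes `D` complementary to its translate by `e`. If `x` starts a run of
`D`, then `x - e - 1 ∈ D`, and `not_triangle` keeps the `e` vertices before `x` out of `D`. Hence
`D` contains `e` vertices from `x` on and `e` more from `x + 2e` on. -/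
theorem hasBergeCycle (h : S.IsSunflower D t₁ t₂ t₃) (hr3 : 3 ≤ r) (hn : n = 2 * r + 2)
    (hd : 2 ≤ d) (hde : d + e = n) (he : 2 ≤ e) : HasBergeCycle S.E (d + 1) := by
  have : NeZero n := ⟨by omega⟩
  by_contra hno
  have hdec := ZMod.natCast_add_natCast_eq_zero hde
  have hDd := ZMod.add_mem_iff_of_add_notMem
    (fun x hx => h.add_notMem (by omega) (by omega) hno (x := x) hx) (by rw [h.card_eq]; omega)
  have hDe : ∀ z : ZMod n, z + e ∈ D ↔ z ∉ D := by
    intro z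
    have := hDd (z + e)
    rw [show z + (e : ZMod n) + d = z by linear_combination hdec] at this
    tauto
  obtain ⟨b, hb⟩ : ∃ b, b ∉ D := ⟨t₁ + d, h.add_notMem (by omega) (by omega) hno h.mem₁⟩
  obtain ⟨x, hx, hx1⟩ := ZMod.exists_mem_sub_one_notMem h.mem₁ hb
  have hxe : x - e - 1 ∈ D := by
    by_contra h'
    apply hx1
    have := (hDe (x - e - 1)).2 h'
    rwa [show x - (e : ZMod n) - 1 + e = x - 1 by ring] at this
  have hgap : ∀ j : ℕ, 1 ≤ j → j ≤ e → x - j ∉ D := by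
    intro j hj1 hj hw
    have hne : x ≠ x - e - 1 := by
      intro h'
      apply ZMod.natCast_ne_zero_of_lt (n := n) (i := e + 1) (by omega) (by omega)
      push_cast
      linear_combination h'
    obtain ⟨A, B, hA, hB, hAB, h1, h2, h3, h4⟩ := h.exists_two_extra hx hw hxe hw
      (fun h' => hne h'.1) (fun h' => hne (h'.1.trans h'.2))
    exact hA.not_triangle hB hAB (by omega) hde hno hj1 hj h1 h3 h2 h4
  have harc : ∀ j : ℕ, j < e → x + j ∈ D := by
    intro j hj
    have h1 := hgap (e - j) (by omega) (by omega)
    have h2 := (hDe _).2 h1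
    rwa [Nat.cast_sub (by omega), show x - ((e : ZMod n) - j) + e = x + j by ring] at h2
  have harc2 : ∀ j : ℕ, j < e → x + e + e + j ∈ D := by
    intro j hj
    have h1 : x + j + e ∉ D := fun h' => (hDe _).1 h' (harc j hj)
    have h2 := (hDe _).2 h1
    rwa [show x + (j : ZMod n) + e + e = x + e + e + j by ring] at h2
  rcases lt_trichotomy d e with hlt | heq | hlt
  · exact h.add_notMem (by omega) (by omega) hno hx (harc d hlt)
  · subst heq
    exact hno (h.hasBergeCycle_of_arc hr3 (by omega) (by omega) harc)
  · by_cases he2 : e = 2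
    · subst he2
      have h1 := hgap 2 (by omega) le_rfl
      push_cast at h1 hDe
      exact hno (h.hasBergeCycle_of_eq_add_two hr3 hx hx1 h1 hde hDe)
    · have h1 := harc (e - 1) (by omega)
      have h2 := harc2 0 (by omega)
      have h3 := harc2 2 (by omega)
      rw [Nat.cast_sub (by omega)] at h1
      push_cast at h1 h2 h3
      rw [add_zero] at h2
      rw [← add_sub_assoc] at h1
      obtain ⟨A, B, hA, hB, hAB, h1, h2, h3, h4⟩ := h.exists_two_extra hx h1 h2 h3
        (fun h' => by
          apply ZMod.natCast_ne_zero_of_lt (n := n) (i := 2 * e) (by omega) (by omega)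
          push_cast
          linear_combination - h'.1)
        (fun h' => by
          apply ZMod.natCast_ne_zero_of_lt (n := n) (i := e + 1) (by omega) (by omega)
          push_cast
          linear_combination - h'.2)
      exact hA.not_quad hB hAB hde he (by omega) hno h1 h2 h3 h4

end IsSunflower

end HamSystem

/-! ### Six extra edges through one vertex: their union has `r + 3` elements. -/

theorem ZMod.card_filter_add_mem {n : ℕ} [NeZero n] (U : Finset (ZMod n)) (c : ZMod n) :
    (U.filter fun x => x + c ∈ U).card + n =
      2 * U.card + (Uᶜ.filter fun x => x + c ∉ U).card := by
  have h1 := Finset.card_filter_add_card_filter_not (s := U) (fun x => x + c ∈ U)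
  have h2 := Finset.card_filter_add_card_filter_not (s := Uᶜ) (fun x => x + c ∈ U)
  have h3 : (Finset.univ.filter fun x => x + c ∈ U).card = U.card := by
    rw [← Finset.card_image_of_injective _ (add_left_injective c)]
    congr 1
    ext z
    simp only [Finset.mem_image, Finset.mem_filter, Finset.mem_univ, true_and]
    exact ⟨fun ⟨a, ha, haz⟩ => haz ▸ ha, fun hz => ⟨z - c, by simpa using hz, by simp⟩⟩
  have h4 : (Finset.univ.filter fun x => x + c ∈ U) =
      (U.filter fun x => x + c ∈ U) ∪ (Uᶜ.filter fun x => x + c ∈ U) := by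
    rw [← Finset.filter_union, Finset.union_compl]
  rw [h4, Finset.card_union_of_disjoint
    (Finset.disjoint_filter_filter (Finset.disjoint_left.2 fun a ha ha' =>
      (Finset.mem_compl.1 ha') ha))] at h3
  have h5 := Finset.card_compl U
  have h6 := Finset.card_le_univ U
  rw [ZMod.card] at h5 h6
  omega

namespace HamSystem

variable {n r : ℕ} {S : HamSystem n r} {d e : ℕ}

theorem exists_isSunflower {D A₁ A₂ A₃ : Finset (ZMod n)} (hD : D.card = r + 1)
    (h₁ : S.IsExtra A₁) (h₂ : S.IsExtra A₂) (h₃ : S.IsExtra A₃) (h12 : A₁ ≠ A₂) (h13 : A₁ ≠ A₃)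
    (h23 : A₂ ≠ A₃) (s₁ : A₁ ⊆ D) (s₂ : A₂ ⊆ D) (s₃ : A₃ ⊆ D) :
    ∃ t₁ t₂ t₃, S.IsSunflower D t₁ t₂ t₃ := by
  have key : ∀ A, S.IsExtra A → A ⊆ D → ∃ t ∈ D, A = D.erase t := by
    intro A hA hs
    have h1 : (D \ A).card = 1 := by
      rw [Finset.card_sdiff_of_subset hs, hD, S.card_eq A hA.1]; omega
    obtain ⟨t, ht⟩ := Finset.card_eq_one.1 h1
    have ht' : t ∈ D \ A := ht ▸ Finset.mem_singleton_self t
    refine ⟨t, (Finset.mem_sdiff.1 ht').1, ?_⟩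
    rw [← Finset.sdiff_singleton_eq_erase, ← ht, Finset.sdiff_sdiff_eq_self hs]
  obtain ⟨t₁, m₁, rfl⟩ := key A₁ h₁ s₁
  obtain ⟨t₂, m₂, rfl⟩ := key A₂ h₂ s₂
  obtain ⟨t₃, m₃, rfl⟩ := key A₃ h₃ s₃
  exact ⟨t₁, t₂, t₃, hD, m₁, m₂, m₃, fun h => h12 (by rw [h]), fun h => h13 (by rw [h]),
    fun h => h23 (by rw [h]), h₁, h₂, h₃⟩

theorem card_filter_subset_le_two (hr3 : 3 ≤ r) (hn : n ≤ 2 * r + 2) (hd : 2 ≤ d)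
    (hde : d + e = n) (he : 2 ≤ e) (hno : ¬ HasBergeCycle S.E (d + 1))
    {F : Finset (Finset (ZMod n))} (hF : ∀ A ∈ F, S.IsExtra A) {D : Finset (ZMod n)}
    (hD : D.card = r + 1) : (F.filter (· ⊆ D)).card ≤ 2 := by
  by_contra! h
  obtain ⟨A₁, h1, A₂, h2, A₃, h3, h12, h13, h23⟩ := Finset.two_lt_card.1 h
  rw [Finset.mem_filter] at h1 h2 h3
  obtain ⟨t₁, t₂, t₃, hs⟩ := exists_isSunflower hD (hF _ h1.1) (hF _ h2.1) (hF _ h3.1) h12 h13 h23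
    h1.2 h2.2 h3.2
  have := hs.two_mul_le (by omega) (by omega) hno
  exact hno (hs.hasBergeCycle hr3 (by omega) hd hde he)

/-- Six extra edges through `0` whose union `U` has `r + 3` elements, with no three of them inside
an `r + 1`-element set. -/
structure IsSixfold (S : HamSystem n r) (d e : ℕ) (F : Finset (Finset (ZMod n)))
    (U : Finset (ZMod n)) : Prop where
  three_le : 3 ≤ r
  n_eq : n = 2 * r + 2
  two_le_d : 2 ≤ d
  two_le_e : 2 ≤ e
  add_eq : d + e = n
  no_cycle : ¬ HasBergeCycle S.E (d + 1)
  card_F : F.card = 6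
  extra : ∀ A ∈ F, S.IsExtra A
  zero_mem : ∀ A ∈ F, (0 : ZMod n) ∈ A
  subset : ∀ A ∈ F, A ⊆ U
  exists_mem : ∀ u ∈ U, ∃ A ∈ F, u ∈ A
  card_U : U.card = r + 3
  codegree_le : ∀ v ∈ U, ∀ w ∈ U, v ≠ w → (F.filter fun A => v ∉ A ∧ w ∉ A).card ≤ 2

/-- Without a 2-cycle the six edges are disjoint away from `0`, and `6 * (r - 1) > 2 * r + 2`. -/
theorem cycle_two_of_six (hr3 : 3 ≤ r) (hn : n ≤ 2 * r + 2) [NeZero n]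
    {F : Finset (Finset (ZMod n))} (hF : F.card = 6) (hext : ∀ A ∈ F, S.IsExtra A)
    (h0 : ∀ A ∈ F, (0 : ZMod n) ∈ A) : HasBergeCycle S.E 2 := by
  by_contra hno
  have h1 : ((F : Set (Finset (ZMod n))).PairwiseDisjoint fun A => A.erase 0) := by
    intro A hA B hB hAB
    rw [Function.onFun, Finset.disjoint_left]
    intro x hx hx'
    rw [Finset.mem_erase] at hx hx'
    exact hno (S.cycle_two_of_mem (hext A hA).1 (hext B hB).1 hAB hx.1 hx.2 (h0 A hA) hx'.2
      (h0 B hB))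
  have h2 := Finset.card_biUnion h1
  have h3 : ∑ A ∈ F, (A.erase 0).card = ∑ _A ∈ F, (r - 1) := Finset.sum_congr rfl fun A hA => by
    rw [Finset.card_erase_of_mem (h0 A hA), S.card_eq A (hext A hA).1]
  rw [h3, Finset.sum_const, hF, smul_eq_mul] at h2
  have h4 := Finset.card_le_univ (F.biUnion fun A => A.erase 0)
  rw [ZMod.card] at h4
  omega

/-- Unless six extra edges through one vertex give the cycle directly, they are sixfold. -/
theorem exists_isSixfold (hr3 : 3 ≤ r) (hn1 : 2 * r + 1 ≤ n) (hn2 : n ≤ 2 * r + 2) (hd : 2 ≤ d)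
    (hde : d + e = n) (he : 2 ≤ e) (hno : ¬ HasBergeCycle S.E (d + 1))
    {F : Finset (Finset (ZMod n))} (hF : F.card = 6) (hext : ∀ A ∈ F, S.IsExtra A)
    (h0 : ∀ A ∈ F, (0 : ZMod n) ∈ A) : ∃ U, S.IsSixfold d e F U := by
  have : NeZero n := ⟨by omega⟩
  have hfil := fun D hD => card_filter_subset_le_two hr3 hn2 hd hde he hno hext (D := D) hD
  set U : Finset (ZMod n) := F.biUnion id with hU
  have hsub : ∀ A ∈ F, A ⊆ U := fun A hA => Finset.subset_biUnion_of_mem id hA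
  have hex : ∀ u ∈ U, ∃ A ∈ F, u ∈ A := fun u hu => by
    simpa [hU] using hu
  have hUcard := card_add_le_of_forall_mem_extra (S := S) (by omega) hde he hno (U := U)
    (fun u hu => by
      obtain ⟨A, hA, huA⟩ := hex u hu
      exact ⟨A, hext A hA, huA, h0 A hA⟩)
  obtain ⟨A₀, hA₀⟩ : F.Nonempty := Finset.card_pos.1 (by omega)
  have hle := Finset.card_le_card (hsub A₀ hA₀)
  rw [S.card_eq A₀ (hext A₀ hA₀).1] at hle
  have c0 : U.card ≠ r := by
    intro h
    have h1 : F ⊆ {U} := by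
      intro A hA
      rw [Finset.mem_singleton]
      exact Finset.eq_of_subset_of_card_le (hsub A hA) (by rw [S.card_eq A (hext A hA).1, h])
    have := Finset.card_le_card h1
    rw [Finset.card_singleton] at this
    omega
  have c1 : U.card ≠ r + 1 := by
    intro h
    have h1 := hfil U h
    rw [Finset.filter_true_of_mem hsub] at h1
    omega
  -- `U` has more than `n / 2` elements, so it contains some `x` and `x + d`. Every member of `F`
  -- misses one of them and so lies in one of two `r + 1`-sets, each holding at most two members.
  have c2 : U.card ≠ r + 2 := by
    intro h
    have h1 : ¬ ∀ x ∈ U, x + (d : ZMod n) ∉ U := by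
      intro h'
      have := ZMod.two_mul_card_le_of_add_notMem h'
      omega
    push Not at h1
    obtain ⟨x, hx, hxd⟩ := h1
    have h2 : F ⊆ F.filter (· ⊆ U.erase x) ∪ F.filter (· ⊆ U.erase (x + d)) := by
      intro A hA
      rw [Finset.mem_union, Finset.mem_filter, Finset.mem_filter]
      by_cases hxA : x ∈ A
      · exact Or.inr ⟨hA, Finset.subset_erase.2 ⟨hsub A hA,
          (hext A hA).add_notMem (by omega) (by omega) hno hxA⟩⟩
      · exact Or.inl ⟨hA, Finset.subset_erase.2 ⟨hsub A hA, hxA⟩⟩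
    have h3 := (Finset.card_le_card h2).trans (Finset.card_union_le _ _)
    have h4 := hfil (U.erase x) (by rw [Finset.card_erase_of_mem hx, h]; rfl)
    have h5 := hfil (U.erase (x + d)) (by rw [Finset.card_erase_of_mem hxd, h]; rfl)
    omega
  have hU3 : U.card = r + 3 := by omega
  refine ⟨U, hr3, by omega, hd, he, hde, hno, hF, hext, h0, hsub, hex, hU3, ?_⟩
  intro v hv w hw hvw
  have h1 := hfil ((U.erase v).erase w) (by
    rw [Finset.card_erase_of_mem (Finset.mem_erase.2 ⟨hvw.symm, hw⟩), Finset.card_erase_of_mem hv,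
      hU3]
    rfl)
  refine le_trans (Finset.card_le_card ?_) h1
  intro A hA
  rw [Finset.mem_filter] at hA ⊢
  exact ⟨hA.1, Finset.subset_erase.2 ⟨Finset.subset_erase.2 ⟨hsub A hA.1, hA.2.1⟩, hA.2.2⟩⟩

namespace IsSixfold

variable {F : Finset (Finset (ZMod n))} {U : Finset (ZMod n)}

theorem neZero (h : S.IsSixfold d e F U) : NeZero n := ⟨by have := h.n_eq; omega⟩

theorem cast_add (h : S.IsSixfold d e F U) : (d : ZMod n) + e = 0 :=
  ZMod.natCast_add_natCast_eq_zero h.add_eq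

theorem zero_mem_U (h : S.IsSixfold d e F U) : (0 : ZMod n) ∈ U := by
  obtain ⟨A, hA⟩ : F.Nonempty := Finset.card_pos.1 (by rw [h.card_F]; omega)
  exact h.subset A hA (h.zero_mem A hA)

theorem add_d_notMem (h : S.IsSixfold d e F U) {A : Finset (ZMod n)} (hA : A ∈ F) {x : ZMod n}
    (hx : x ∈ A) : x + d ∉ A := by
  have h1 := h.two_le_d
  have h2 := h.add_eq
  have h3 := h.two_le_e
  exact (h.extra A hA).add_notMem (by omega) (by omega) h.no_cycle hx

theorem add_notMem (h : S.IsSixfold d e F U) {A : Finset (ZMod n)} (hA : A ∈ F) {x : ZMod n}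
    (hx : x ∈ A) : x + e ∉ A := by
  intro h'
  have := h.add_d_notMem hA h'
  rw [show x + (e : ZMod n) + d = x by linear_combination h.cast_add] at this
  exact this hx

theorem sub_notMem (h : S.IsSixfold d e F U) {A : Finset (ZMod n)} (hA : A ∈ F) {x : ZMod n}
    (hx : x ∈ A) : x - e ∉ A := by
  intro h'
  have := h.add_notMem hA h'
  rw [sub_add_cancel] at this
  exact this hx

theorem card_sdiff (h : S.IsSixfold d e F U) {A : Finset (ZMod n)} (hA : A ∈ F) :
    (U \ A).card = 3 := by
  rw [Finset.card_sdiff_of_subset (h.subset A hA), h.card_U, S.card_eq A (h.extra A hA).1]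
  omega

theorem eq_sdiff (h : S.IsSixfold d e F U) {A : Finset (ZMod n)} (hA : A ∈ F) {x y z : ZMod n}
    (hx : x ∈ U) (hy : y ∈ U) (hz : z ∈ U) (hxA : x ∉ A) (hyA : y ∉ A) (hzA : z ∉ A) (hxy : x ≠ y)
    (hxz : x ≠ z) (hyz : y ≠ z) : A = U \ {x, y, z} := by
  have h1 : ({x, y, z} : Finset (ZMod n)) ⊆ U \ A := by
    intro u hu
    simp only [Finset.mem_insert, Finset.mem_singleton] at hu
    rw [Finset.mem_sdiff]
    rcases hu with rfl | rfl | rfl <;> exact ⟨by assumption, by assumption⟩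
  have h2 := Finset.eq_of_subset_of_card_le h1 (by
    rw [h.card_sdiff hA, Finset.card_eq_three.2 ⟨x, y, z, hxy, hxz, hyz, rfl⟩])
  rw [h2, Finset.sdiff_sdiff_eq_self (h.subset A hA)]

/-- The `4` is `2 * (r + 3) - (2 * r + 2)`. -/
theorem card_filter_add_mem [NeZero n] (h : S.IsSixfold d e F U) :
    (U.filter fun x => x + (e : ZMod n) ∈ U).card =
      4 + (Finset.univ.filter fun x => x ∉ U ∧ x + (e : ZMod n) ∉ U).card := by
  have h1 := ZMod.card_filter_add_mem U (e : ZMod n)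
  have h2 := h.n_eq
  have h3 : (Uᶜ.filter fun x => x + (e : ZMod n) ∉ U) =
      Finset.univ.filter fun x => x ∉ U ∧ x + (e : ZMod n) ∉ U := by
    ext; simp
  rw [h.card_U, h3] at h1
  omega

/-- Take a pair `x, x + e` in `U` avoiding `v`. A member that misses `v` also misses `x` or `x + e`,
and `codegree_le` allows at most `2 + 2` of these. -/
theorem two_le_card_filter_mem (h : S.IsSixfold d e F U) {v : ZMod n} (hv : v ∈ U) :
    2 ≤ (F.filter fun A => v ∈ A).card := by
  have := h.neZero
  obtain ⟨x, hx, hxv⟩ : ∃ x ∈ U.filter fun x => x + (e : ZMod n) ∈ U, x ∉ ({v, v - e} : Finset (ZMod n)) := by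
    apply Finset.exists_mem_notMem_of_card_lt_card
    rw [h.card_filter_add_mem]
    exact lt_of_le_of_lt Finset.card_le_two (by omega)
  rw [Finset.mem_filter] at hx
  simp only [Finset.mem_insert, Finset.mem_singleton, not_or] at hxv
  have h1 : F.filter (fun A => v ∉ A) ⊆ F.filter (fun A => v ∉ A ∧ x ∉ A) ∪
      F.filter (fun A => v ∉ A ∧ x + e ∉ A) := by
    intro A hA
    rw [Finset.mem_filter] at hA
    rw [Finset.mem_union, Finset.mem_filter, Finset.mem_filter]
    by_cases hxA : x ∈ A
    · exact Or.inr ⟨hA.1, hA.2, h.add_notMem hA.1 hxA⟩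
    · exact Or.inl ⟨hA.1, hA.2, hxA⟩
  have h2 := (Finset.card_le_card h1).trans (Finset.card_union_le _ _)
  have h3 := h.codegree_le v hv x hx.1 (Ne.symm hxv.1)
  have h4 := h.codegree_le v hv (x + e) hx.2 (fun h' => hxv.2 (eq_sub_of_add_eq h'.symm))
  have h5 := Finset.card_filter_add_card_filter_not (s := F) (fun A => v ∈ A)
  rw [h.card_F] at h5
  omega

theorem exists_two_mem (h : S.IsSixfold d e F U) {v : ZMod n} (hv : v ∈ U) :
    ∃ A ∈ F, ∃ B ∈ F, A ≠ B ∧ v ∈ A ∧ v ∈ B := by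
  obtain ⟨A, hA, B, hB, hAB⟩ := Finset.one_lt_card.1 (h.two_le_card_filter_mem hv)
  rw [Finset.mem_filter] at hA hB
  exact ⟨A, hA.1, B, hB.1, hAB, hA.2, hB.2⟩

theorem exists_ne_mem (h : S.IsSixfold d e F U) {v : ZMod n} (hv : v ∈ U) (A : Finset (ZMod n)) :
    ∃ B ∈ F, A ≠ B ∧ v ∈ B := by
  obtain ⟨B, hB, C, hC, hBC, h1, h2⟩ := h.exists_two_mem hv
  by_cases hAB : A = B
  · exact ⟨C, hC, hAB ▸ hBC, h2⟩
  · exact ⟨B, hB, hAB, h1⟩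

end IsSixfold

end HamSystem

/-! ### The antipodal case `d = e`. -/

namespace HamSystem

namespace IsSixfold

variable {n r : ℕ} {S : HamSystem n r} {d e : ℕ}
variable {F : Finset (Finset (ZMod n))} {U : Finset (ZMod n)}

theorem natCast_notMem (h : S.IsSixfold d e F U) : (e : ZMod n) ∉ U := by
  intro he
  obtain ⟨A, hA, heA⟩ := h.exists_mem _ he
  have := h.add_notMem hA (h.zero_mem A hA)
  rw [zero_add] at this
  exact this heA

/-- No pair of `U` at distance `e + 1` surrounds the common vertex `0`. -/
theorem not_around_zero (h : S.IsSixfold d e F U) {j : ℕ} (hj1 : 1 ≤ j) (hj : j ≤ e)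
    (hx : (j : ZMod n) ∈ U) (hy : (j : ZMod n) - e - 1 ∈ U) : False := by
  obtain ⟨A, hA, hxA⟩ := h.exists_mem _ hx
  obtain ⟨B, hB, hAB, hyB⟩ := h.exists_ne_mem hy A
  have hd := h.two_le_d
  refine (h.extra A hA).not_triangle (h.extra B hB) hAB (by omega) h.add_eq h.no_cycle hj1 hj hxA
    hyB ?_ ?_
  · rw [sub_self]; exact h.zero_mem A hA
  · rw [sub_self]; exact h.zero_mem B hB

/-- The elements below `e` of `U` whose translate by `e` is also in `U`. -/
def doubled (U : Finset (ZMod n)) (e : ℕ) : Finset ℕ :=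
  (Finset.range e).filter fun j => (j : ZMod n) ∈ U ∧ (j : ZMod n) + e ∈ U

theorem mem_doubled {j : ℕ} :
    j ∈ doubled U e ↔ j < e ∧ (j : ZMod n) ∈ U ∧ (j : ZMod n) + e ∈ U := by
  rw [doubled, Finset.mem_filter, Finset.mem_range]

section Antipodal

variable (h : S.IsSixfold e e F U)
include h

theorem two_mul_eq : 2 * e = n := by have := h.add_eq; omega

theorem exists_rep (x : ZMod n) : ∃ j : ℕ, j < e ∧ (x = j ∨ x = j + e) := by
  have := h.neZero
  have h1 := h.two_mul_eq
  obtain ⟨q, hq, rfl⟩ := ZMod.exists_natCast_eq_sub 0 x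
  by_cases hqe : q < e
  · exact ⟨q, hqe, Or.inl (by simp)⟩
  · refine ⟨q - e, by omega, Or.inr ?_⟩
    rw [Nat.cast_sub (by omega)]
    ring

theorem natCast_ne_natCast_add {i j : ℕ} (hi : i < e) (hj : j < e) :
    (i : ZMod n) ≠ (j : ZMod n) + e := by
  have h1 := h.two_mul_eq
  rw [← Nat.cast_add]
  exact ZMod.natCast_ne_of_lt (by omega) (by omega)

theorem natCast_inj {i j : ℕ} (hi : i < e) (hj : j < e) (hij : (i : ZMod n) = j) : i = j := by
  have h1 := h.two_mul_eq
  exact ZMod.natCast_inj_of_lt (by omega) (by omega) hij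

theorem pos_of_mem_doubled {j : ℕ} (hj : j ∈ doubled U e) : 0 < j := by
  rcases Nat.eq_zero_or_pos j with rfl | hj0
  · have := (mem_doubled.1 hj).2.2
    rw [Nat.cast_zero, zero_add] at this
    exact absurd this h.natCast_notMem
  · exact hj0

theorem card_le_two_mul_card_doubled [NeZero n] :
    4 + (Finset.univ.filter fun x => x ∉ U ∧ x + (e : ZMod n) ∉ U).card ≤
      2 * (doubled U e).card := by
  rw [← h.card_filter_add_mem]
  have h1 : (U.filter fun x => x + (e : ZMod n) ∈ U) ⊆
      (doubled U e).image (fun j : ℕ => (j : ZMod n)) ∪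
        (doubled U e).image (fun j : ℕ => (j : ZMod n) + e) := by
    intro x hx
    rw [Finset.mem_filter] at hx
    rw [Finset.mem_union, Finset.mem_image, Finset.mem_image]
    obtain ⟨j, hj, rfl | rfl⟩ := h.exists_rep x
    · exact Or.inl ⟨j, mem_doubled.2 ⟨hj, hx⟩, rfl⟩
    · refine Or.inr ⟨j, mem_doubled.2 ⟨hj, ?_, hx.1⟩, rfl⟩
      have := hx.2
      rwa [add_assoc, h.cast_add, add_zero] at this
  have h2 := (Finset.card_le_card h1).trans (Finset.card_union_le _ _)
  have h3 := Finset.card_image_le (s := doubled U e) (f := fun j : ℕ => (j : ZMod n))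
  have h4 := Finset.card_image_le (s := doubled U e) (f := fun j : ℕ => (j : ZMod n) + e)
  omega

/-- A system of distinct missed vertices: `A` misses at least one end of each doubled pair, and it
misses only three vertices of `U`. -/
theorem image_doubled_subset {A : Finset (ZMod n)} (hA : A ∈ F) :
    (doubled U e).image (fun j : ℕ => if (j : ZMod n) ∈ A then (j : ZMod n) + e else j) ⊆ U \ A ∧
    ((doubled U e).image fun j : ℕ => if (j : ZMod n) ∈ A then (j : ZMod n) + e else j).card =
      (doubled U e).card := by
  constructor
  · intro x hx
    obtain ⟨j, hj, rfl⟩ := Finset.mem_image.1 hx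
    have hj := mem_doubled.1 hj
    rw [Finset.mem_sdiff]
    split_ifs with hjA
    · exact ⟨hj.2.2, h.add_notMem hA hjA⟩
    · exact ⟨hj.2.1, hjA⟩
  · apply Finset.card_image_of_injOn
    intro i hi j hj hij
    have hi := (mem_doubled.1 hi).1
    have hj := (mem_doubled.1 hj).1
    dsimp only at hij
    split_ifs at hij with h1 h2 h2
    · exact h.natCast_inj hi hj (add_right_cancel hij)
    · exact absurd hij.symm (h.natCast_ne_natCast_add hj hi)
    · exact absurd hij (h.natCast_ne_natCast_add hi hj)
    · exact h.natCast_inj hi hj hij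

theorem card_doubled_le : (doubled U e).card ≤ 3 := by
  obtain ⟨A, hA⟩ : F.Nonempty := Finset.card_pos.1 (by rw [h.card_F]; omega)
  have h1 := h.image_doubled_subset hA
  rw [← h1.2, ← h.card_sdiff hA]
  exact Finset.card_le_card h1.1

theorem mem_or_add_mem (hY : (doubled U e).card = 3) {A : Finset (ZMod n)} (hA : A ∈ F) {j : ℕ}
    (hj : j ∈ doubled U e) : (j : ZMod n) ∈ A ∨ (j : ZMod n) + e ∈ A := by
  by_contra! hc
  have h1 := h.image_doubled_subset hA
  have h2 := Finset.eq_of_subset_of_card_le h1.1 (by rw [h1.2, hY, h.card_sdiff hA])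
  have h3 : (j : ZMod n) + e ∈ U \ A := Finset.mem_sdiff.2 ⟨(mem_doubled.1 hj).2.2, hc.2⟩
  rw [← h2] at h3
  obtain ⟨i, hi, hij⟩ := Finset.mem_image.1 h3
  have hje := (mem_doubled.1 hj).1
  have hie := (mem_doubled.1 hi).1
  split_ifs at hij with hiA
  · have := h.natCast_inj hie hje (add_right_cancel hij)
    exact hc.1 (this ▸ hiA)
  · exact h.natCast_ne_natCast_add hie hje hij

theorem eq_of_forall_mem (hY : (doubled U e).card = 3) {A : Finset (ZMod n)} (hA : A ∈ F)
    (hj : ∀ j ∈ doubled U e, (j : ZMod n) ∈ A) :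
    A = U \ (doubled U e).image fun j : ℕ => (j : ZMod n) + e := by
  have h1 : ((doubled U e).image fun j : ℕ => (j : ZMod n) + e) ⊆ U \ A := by
    intro x hx
    obtain ⟨j, hj', rfl⟩ := Finset.mem_image.1 hx
    exact Finset.mem_sdiff.2 ⟨(mem_doubled.1 hj').2.2, h.add_notMem hA (hj j hj')⟩
  have h2 := Finset.eq_of_subset_of_card_le h1 (by
    rw [h.card_sdiff hA, ← hY, Finset.card_image_of_injOn]
    intro i hi j hj hij
    exact h.natCast_inj (mem_doubled.1 hi).1 (mem_doubled.1 hj).1 (add_right_cancel hij))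
  rw [h2, Finset.sdiff_sdiff_eq_self (h.subset A hA)]

theorem eq_of_forall_add_mem (hY : (doubled U e).card = 3) {A : Finset (ZMod n)} (hA : A ∈ F)
    (hj : ∀ j ∈ doubled U e, (j : ZMod n) + e ∈ A) :
    A = U \ (doubled U e).image fun j : ℕ => (j : ZMod n) := by
  have h1 : ((doubled U e).image fun j : ℕ => (j : ZMod n)) ⊆ U \ A := by
    intro x hx
    obtain ⟨j, hj', rfl⟩ := Finset.mem_image.1 hx
    refine Finset.mem_sdiff.2 ⟨(mem_doubled.1 hj').2.1, fun hjA => ?_⟩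
    exact h.add_notMem hA hjA (hj j hj')
  have h2 := Finset.eq_of_subset_of_card_le h1 (by
    rw [h.card_sdiff hA, ← hY, Finset.card_image_of_injOn]
    intro i hi j hj hij
    exact h.natCast_inj (mem_doubled.1 hi).1 (mem_doubled.1 hj).1 hij)
  rw [h2, Finset.sdiff_sdiff_eq_self (h.subset A hA)]

/-- With three doubled pairs, a member is determined by the ends it contains. If `A` contained `1`
and the far end `j + e`, then `A` and a member through `0` and `j` would close an arc broken after
`0`. So a member through `1` contains every near end and is unique, whereas each vertex of `U` is in
two members. -/
theorem one_notMem (hY : (doubled U e).card = 3) : (1 : ZMod n) ∉ U := by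
  intro h1
  have hall : ∀ A ∈ F, (1 : ZMod n) ∈ A →
      A = U \ (doubled U e).image fun j : ℕ => (j : ZMod n) + e := by
    intro A hA h1A
    refine h.eq_of_forall_mem hY hA fun j hj => ?_
    by_contra hjA
    have hjA' := (h.mem_or_add_mem hY hA hj).resolve_left hjA
    have hj' := mem_doubled.1 hj
    have hj0 := h.pos_of_mem_doubled hj
    obtain ⟨B, hB, hjB⟩ := h.exists_mem _ hj'.2.1
    have hn := h.two_mul_eq
    have hc := h.cast_add
    have e1 : ((e - j : ℕ) : ZMod n) = e - j := Nat.cast_sub (by omega)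
    refine (h.extra A hA).not_broken (h.extra B hB) (fun hAB => hjA (hAB ▸ hjB)) (d := e)
      (by omega) h.no_cycle (j := e - j) (by omega) hjA' ?_ ?_ ?_
    · convert h1A using 1; rw [e1]; linear_combination hc
    · convert h.zero_mem B hB using 1; rw [e1]; linear_combination hc
    · convert hjB using 1; linear_combination hc
  obtain ⟨A, hA, B, hB, hAB, hA1, hB1⟩ := h.exists_two_mem h1
  exact hAB ((hall A hA hA1).trans (hall B hB hB1).symm)

theorem neg_one_notMem (hY : (doubled U e).card = 3) : (-1 : ZMod n) ∉ U := by
  intro h1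
  have hall : ∀ A ∈ F, (-1 : ZMod n) ∈ A →
      A = U \ (doubled U e).image fun j : ℕ => (j : ZMod n) := by
    intro A hA h1A
    refine h.eq_of_forall_add_mem hY hA fun j hj => ?_
    by_contra hjA
    have hjA' := (h.mem_or_add_mem hY hA hj).resolve_right hjA
    have hj' := mem_doubled.1 hj
    have hj0 := h.pos_of_mem_doubled hj
    obtain ⟨B, hB, hjB⟩ := h.exists_mem _ hj'.2.2
    have hn := h.two_mul_eq
    have hc := h.cast_add
    have e1 : ((e - j - 1 : ℕ) : ZMod n) = e - j - 1 := by
      rw [Nat.cast_sub (by omega), Nat.cast_sub (by omega), Nat.cast_one]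
    refine (h.extra B hB).not_broken (h.extra A hA) (fun hAB => hjA (hAB ▸ hjB)) (d := e)
      (by omega) h.no_cycle (j := e - j - 1) (by omega) hjB ?_ ?_ ?_
    · convert h.zero_mem B hB using 1; rw [e1]; linear_combination hc
    · convert h1A using 1; rw [e1]; linear_combination hc
    · convert hjA' using 1; linear_combination hc
  obtain ⟨A, hA, B, hB, hAB, hA1, hB1⟩ := h.exists_two_mem h1
  exact hAB ((hall A hA hA1).trans (hall B hB hB1).symm)

theorem not_add_mem_of_mem {j : ℕ} (hj : j < e) (h1 : ((j + 1 : ℕ) : ZMod n) ∈ U) :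
    (j : ZMod n) + e ∉ U := by
  intro h2
  refine h.not_around_zero (j := j + 1) (by omega) (by omega) h1 ?_
  convert h2 using 1
  push_cast
  linear_combination - h.cast_add

/-- `not_add_mem_of_mem` links the pair of `j` to that of `j + 1`. If some pair avoids `U`, there
are three doubled pairs and exactly one empty pair `c`; starting from `1 ∉ U` and `-1 ∉ U`,
non-membership spreads to `c` from both sides and leaves no room for a doubled pair. If no pair
avoids `U`, membership spreads down from one doubled pair to the next and contradicts the latter. -/
theorem false_of_antipodal : False := by
  have := h.neZero
  have hcard := h.card_le_two_mul_card_doubled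
  have hY3 := h.card_doubled_le
  have hc := h.cast_add
  by_cases hZ : ∃ z, z ∉ U ∧ z + (e : ZMod n) ∉ U
  · obtain ⟨z, hz⟩ := hZ
    obtain ⟨c, hce, hcU, hcU'⟩ : ∃ c : ℕ, c < e ∧ (c : ZMod n) ∉ U ∧ (c : ZMod n) + e ∉ U := by
      obtain ⟨c, hce, rfl | rfl⟩ := h.exists_rep z
      · exact ⟨c, hce, hz⟩
      · refine ⟨c, hce, ?_, hz.1⟩
        have := hz.2
        rwa [add_assoc, hc, add_zero] at this
    have hY : (doubled U e).card = 3 := by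
      have : 1 < (Finset.univ.filter fun x => x ∉ U ∧ x + (e : ZMod n) ∉ U).card := by
        refine Finset.one_lt_card.2 ⟨c, by simp [hcU, hcU'], c + e, ?_,
          h.natCast_ne_natCast_add hce hce⟩
        rw [Finset.mem_filter, add_assoc, hc, add_zero]
        exact ⟨Finset.mem_univ _, hcU', hcU⟩
      omega
    have huniq : ∀ j : ℕ, j < e → (j : ZMod n) ∉ U → (j : ZMod n) + e ∉ U → j = c := by
      intro j hj h1 h2
      by_contra hjc
      have : 2 < (Finset.univ.filter fun x => x ∉ U ∧ x + (e : ZMod n) ∉ U).card := by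
        refine Finset.two_lt_card.2 ⟨c, by simp [hcU, hcU'], c + e, ?_, j, by simp [h1, h2],
          h.natCast_ne_natCast_add hce hce, fun h' => hjc (h.natCast_inj hce hj h').symm,
          (h.natCast_ne_natCast_add hj hce).symm⟩
        rw [Finset.mem_filter, add_assoc, hc, add_zero]
        exact ⟨Finset.mem_univ _, hcU', hcU⟩
      omega
    have hup : ∀ m : ℕ, m + 1 ≤ c → ((m + 1 : ℕ) : ZMod n) ∉ U := by
      intro m
      induction m with
      | zero => intro _; simpa using h.one_notMem hY
      | succ m ih =>
        intro hm hmem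
        have := huniq (m + 1) (by omega) (ih (by omega)) (h.not_add_mem_of_mem (by omega) hmem)
        omega
    have hdown : ∀ m : ℕ, m + 1 ≤ e → c ≤ e - (m + 1) →
        ((e - (m + 1) : ℕ) : ZMod n) + e ∉ U := by
      intro m
      induction m with
      | zero =>
        intro he _ hmem
        apply h.neg_one_notMem hY
        convert hmem using 1
        rw [Nat.cast_sub (by omega)]
        push_cast
        linear_combination - hc
      | succ m ih =>
        intro he hm hmem
        have h1 : ((e - (m + 1) : ℕ) : ZMod n) ∉ U := by
          intro h'
          refine h.not_add_mem_of_mem (j := e - (m + 1 + 1)) (by omega) ?_ hmem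
          rwa [show e - (m + 1 + 1) + 1 = e - (m + 1) by omega]
        have := huniq (e - (m + 1)) (by omega) h1 (ih (by omega) (by omega))
        omega
    obtain ⟨j, hj⟩ : (doubled U e).Nonempty := Finset.card_pos.1 (by omega)
    have hj0 := h.pos_of_mem_doubled hj
    have hj' := mem_doubled.1 hj
    rcases le_total j c with hjc | hjc
    · apply hup (j - 1) (by omega)
      rw [Nat.sub_add_cancel hj0]
      exact hj'.2.1
    · apply hdown (e - j - 1) (by omega) (by omega)
      rw [show e - (e - j - 1 + 1) = j by omega]
      exact hj'.2.2
  · push Not at hZ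
    have h2 : 1 < (doubled U e).card := by omega
    obtain ⟨a, ha, b, hb, hab⟩ : ∃ a ∈ doubled U e, ∃ b ∈ doubled U e, a < b := by
      obtain ⟨a, ha, b, hb, hab⟩ := Finset.one_lt_card.1 h2
      rcases lt_or_gt_of_ne hab with hlt | hlt
      · exact ⟨a, ha, b, hb, hlt⟩
      · exact ⟨b, hb, a, ha, hlt⟩
    have ha' := mem_doubled.1 ha
    have hb' := mem_doubled.1 hb
    have hdown : ∀ m : ℕ, m ≤ b → ((b - m : ℕ) : ZMod n) ∈ U := by
      intro m
      induction m with
      | zero => intro _; exact hb'.2.1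
      | succ m ih =>
        intro hm
        by_contra h'
        refine h.not_add_mem_of_mem (j := b - (m + 1)) (by omega) ?_ (hZ _ h')
        rw [show b - (m + 1) + 1 = b - m by omega]
        exact ih (by omega)
    have h1 := hdown (b - (a + 1)) (by omega)
    rw [show b - (b - (a + 1)) = a + 1 by omega] at h1
    exact h.not_add_mem_of_mem ha'.1 h1 ha'.2.2

end Antipodal

end IsSixfold

end HamSystem

/-! ### The case `d ≠ e`: pairs of `U` at distance `e`. -/

namespace HamSystem

namespace IsSixfold

variable {n r : ℕ} {S : HamSystem n r} {d e : ℕ}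
variable {F : Finset (Finset (ZMod n))} {U : Finset (ZMod n)}

theorem e_ne_zero (h : S.IsSixfold d e F U) : (e : ZMod n) ≠ 0 := by
  have h1 := h.two_le_d
  have h2 := h.two_le_e
  have h3 := h.add_eq
  exact ZMod.natCast_ne_zero_of_lt (by omega) (by omega)

theorem two_e_ne_zero (h : S.IsSixfold d e F U) (hde : d ≠ e) : (e : ZMod n) + e ≠ 0 := by
  have h1 := h.two_le_d
  have h2 := h.two_le_e
  have h3 := h.add_eq
  intro h0
  rw [← Nat.cast_add, ZMod.natCast_eq_zero_iff] at h0
  obtain ⟨c, hc⟩ := h0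
  have : c = 1 := by
    rcases c with _ | _ | c
    · omega
    · rfl
    · exfalso; nlinarith
  subst this
  omega

/-- Otherwise a member and its translates by `e` and `-e` are pairwise disjoint, but `3 * r > 2 * r
+ 2`. -/
theorem three_e_ne_zero (h : S.IsSixfold d e F U) : (e : ZMod n) + e + e ≠ 0 := by
  have := h.neZero
  intro h0
  obtain ⟨A, hA⟩ : F.Nonempty := Finset.card_pos.1 (by rw [h.card_F]; omega)
  have h1 : Disjoint A (A.image (· + (e : ZMod n))) := by
    rw [Finset.disjoint_right]
    intro z hz
    obtain ⟨u, hu, rfl⟩ := Finset.mem_image.1 hz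
    exact h.add_notMem hA hu
  have h2 : Disjoint (A ∪ A.image (· + (e : ZMod n))) (A.image (· - (e : ZMod n))) := by
    rw [Finset.disjoint_right]
    intro z hz hz'
    obtain ⟨u, hu, rfl⟩ := Finset.mem_image.1 hz
    rcases Finset.mem_union.1 hz' with hz' | hz'
    · exact h.sub_notMem hA hu hz'
    · obtain ⟨v, hv, hvu⟩ := Finset.mem_image.1 hz'
      apply h.add_notMem hA hu
      rwa [show u + (e : ZMod n) = v by linear_combination h0 - hvu]
  have h3 := Finset.card_le_univ ((A ∪ A.image (· + (e : ZMod n))) ∪ A.image (· - (e : ZMod n)))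
  rw [Finset.card_union_of_disjoint h2, Finset.card_union_of_disjoint h1,
    Finset.card_image_of_injective _ (add_left_injective _),
    Finset.card_image_of_injective _ (sub_left_injective), S.card_eq A (h.extra A hA).1,
    ZMod.card] at h3
  have := h.n_eq
  have := h.three_le
  omega

/-- The middle points of arithmetic progressions of length three and difference `e` in `U`. -/
def middles (U : Finset (ZMod n)) (e : ℕ) : Finset (ZMod n) :=
  U.filter fun m => m + (e : ZMod n) ∈ U ∧ m - (e : ZMod n) ∈ U

theorem mem_middles {m : ZMod n} :
    m ∈ middles U e ↔ m ∈ U ∧ m + (e : ZMod n) ∈ U ∧ m - (e : ZMod n) ∈ U := by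
  rw [middles, Finset.mem_filter]

/-- The starting points of maximal progressions of length two and difference `e` in `U`. -/
def isolated (U : Finset (ZMod n)) (e : ℕ) : Finset (ZMod n) :=
  U.filter fun p => p + (e : ZMod n) ∈ U ∧ p - (e : ZMod n) ∉ U ∧ p + (e : ZMod n) + e ∉ U

theorem mem_isolated {p : ZMod n} :
    p ∈ isolated U e ↔ p ∈ U ∧ p + (e : ZMod n) ∈ U ∧ p - (e : ZMod n) ∉ U ∧
      p + (e : ZMod n) + e ∉ U := by
  rw [isolated, Finset.mem_filter]

/-- `A` misses one end of each isolated pair, besides the vertices of `P`, and only three vertices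
in all. -/
theorem card_isolated_add_le (h : S.IsSixfold d e F U) {A P : Finset (ZMod n)} (hA : A ∈ F)
    (hP : P ⊆ U \ A) (hPI : ∀ y ∈ P, ∀ x ∈ isolated U e, y ≠ x ∧ y ≠ x + e) :
    (isolated U e).card + P.card ≤ 3 := by
  let f : ZMod n → ZMod n := fun x => if x ∈ A then x + e else x
  have hf : Set.InjOn f (isolated U e : Finset (ZMod n)) := by
    intro x hx y hy hxy
    have hx := mem_isolated.1 hx
    have hy := mem_isolated.1 hy
    simp only [f] at hxy
    split_ifs at hxy
    · exact add_right_cancel hxy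
    · rw [← hxy, add_sub_cancel_right] at hy
      exact absurd hx.1 hy.2.2.1
    · rw [hxy, add_sub_cancel_right] at hx
      exact absurd hy.1 hx.2.2.1
    · exact hxy
  have hdisj : Disjoint ((isolated U e).image f) P := by
    rw [Finset.disjoint_left]
    intro z hz hz'
    obtain ⟨x, hx, rfl⟩ := Finset.mem_image.1 hz
    have := hPI _ hz' x hx
    simp only [f] at this
    split_ifs at this with hxA
    · exact this.2 rfl
    · exact this.1 rfl
  have hsub : (isolated U e).image f ∪ P ⊆ U \ A := by
    apply Finset.union_subset _ hP
    intro z hz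
    obtain ⟨x, hx, rfl⟩ := Finset.mem_image.1 hz
    have hx := mem_isolated.1 hx
    rw [Finset.mem_sdiff]
    simp only [f]
    split_ifs with hxA
    · exact ⟨hx.2.1, h.add_notMem hA hxA⟩
    · exact ⟨hx.1, hxA⟩
  have h1 := Finset.card_le_card hsub
  rwa [Finset.card_union_of_disjoint hdisj, Finset.card_image_of_injOn hf, h.card_sdiff hA] at h1

/-- `U` contains a progression `m - e, m, m + e, m + 2e` and a separate pair `p, p + e`; the six
sets are the complements in `U` of the three-element sets that meet each pair at distance `e`. -/
structure IsPathPair (S : HamSystem n r) (d e : ℕ) (F : Finset (Finset (ZMod n)))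
    (U : Finset (ZMod n)) (m p : ZMod n) : Prop extends S.IsSixfold d e F U where
  ne : d ≠ e
  compl_add : ∀ z, z ∉ U → z + e ∈ U
  mid_mem : m ∈ U
  mid_add_mem : m + (e : ZMod n) ∈ U
  p_mem : p ∈ U
  p_add_mem : p + e ∈ U
  p_sub_notMem : p - e ∉ U
  p_add_add_notMem : p + e + e ∉ U
  ne_of_eq : ∀ y, y = p ∨ y = p + (e : ZMod n) →
    m ≠ y ∧ m + (e : ZMod n) ≠ y ∧ m - (e : ZMod n) ≠ y ∧ m + (e : ZMod n) + e ≠ y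
  mem_F : ∀ y, y = p ∨ y = p + e →
    U \ {m, m + (e : ZMod n), y} ∈ F ∧ U \ {m + (e : ZMod n), m - (e : ZMod n), y} ∈ F ∧
      U \ {m, m + (e : ZMod n) + e, y} ∈ F
  eq_of_mem : ∀ A ∈ F, ∃ y, (y = p ∨ y = p + e) ∧ (A = U \ {m, m + (e : ZMod n), y} ∨
    A = U \ {m + (e : ZMod n), m - (e : ZMod n), y} ∨ A = U \ {m, m + (e : ZMod n) + e, y})

section

variable (h : S.IsSixfold d e F U) (hde : d ≠ e)
include h hde

theorem add_ne_sub (m : ZMod n) : m + (e : ZMod n) ≠ m - e := by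
  intro h'
  exact h.two_e_ne_zero hde (by linear_combination h')

/-- A member through `m` misses both neighbours `m + e` and `m - e`, so `codegree_le` bounds the
number of these members. -/
theorem card_filter_middle {m : ZMod n} (hm : m ∈ middles U e) :
    (F.filter fun A => m ∈ A).card = 2 := by
  have hm := mem_middles.1 hm
  refine le_antisymm ?_ (h.two_le_card_filter_mem hm.1)
  refine le_trans (Finset.card_le_card ?_)
    (h.codegree_le _ hm.2.1 _ hm.2.2 (h.add_ne_sub hde m))
  intro A hA
  rw [Finset.mem_filter] at hA ⊢
  exact ⟨hA.1, h.add_notMem hA.1 hA.2, h.sub_notMem hA.1 hA.2⟩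

/-- Inclusion-exclusion: two members contain `m`, two contain `m'` and at most two avoid both. As
there are six, no member contains both. -/
theorem middle_notMem {m m' : ZMod n} (hm : m ∈ middles U e) (hm' : m' ∈ middles U e)
    (hne : m ≠ m') {A : Finset (ZMod n)} (hA : A ∈ F) (hmA : m ∈ A) : m' ∉ A := by
  intro hmA'
  have h1 := h.card_filter_middle hde hm
  have h2 := h.card_filter_middle hde hm'
  have h3 := h.codegree_le m (mem_middles.1 hm).1 m' (mem_middles.1 hm').1 hne
  have h4 := Finset.card_union_add_card_inter (F.filter fun A => m ∈ A) (F.filter fun A => m' ∈ A)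
  have h5 : 0 < ((F.filter fun A => m ∈ A) ∩ (F.filter fun A => m' ∈ A)).card :=
    Finset.card_pos.2 ⟨A, Finset.mem_inter.2 ⟨Finset.mem_filter.2 ⟨hA, hmA⟩,
      Finset.mem_filter.2 ⟨hA, hmA'⟩⟩⟩
  have h6 : F ⊆ ((F.filter fun A => m ∈ A) ∪ (F.filter fun A => m' ∈ A)) ∪
      F.filter fun A => m ∉ A ∧ m' ∉ A := by
    intro B hB
    simp only [Finset.mem_union, Finset.mem_filter]
    tauto
  have h7 := (Finset.card_le_card h6).trans (Finset.card_union_le _ _)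
  rw [h.card_F] at h7
  omega

/-- Otherwise a member through `m` must miss the three vertices `m'`, `m + e` and `m - e`. It would
be unique, but two members contain `m`. -/
theorem middle_eq {m m' : ZMod n} (hm : m ∈ middles U e) (hm' : m' ∈ middles U e)
    (hne : m ≠ m') : m' = m + e ∨ m' = m - e := by
  by_contra! hc
  obtain ⟨A, hA, B, hB, hAB, hmA, hmB⟩ := h.exists_two_mem (mem_middles.1 hm).1
  have key : ∀ A ∈ F, m ∈ A → A = U \ {m', m + (e : ZMod n), m - (e : ZMod n)} := fun A hA hmA =>
    h.eq_sdiff hA (mem_middles.1 hm').1 (mem_middles.1 hm).2.1 (mem_middles.1 hm).2.2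
      (h.middle_notMem hde hm hm' hne hA hmA) (h.add_notMem hA hmA) (h.sub_notMem hA hmA) hc.1 hc.2
      (h.add_ne_sub hde m)
  exact hAB ((key A hA hmA).trans (key B hB hmB).symm)

theorem card_middles_le : (middles U e).card ≤ 2 := by
  by_contra! hc
  obtain ⟨a, ha, b, hb, c, hc, hab, hac, hbc⟩ := Finset.two_lt_card.1 hc
  have h2 := h.two_e_ne_zero hde
  have h3 := h.three_e_ne_zero
  rcases h.middle_eq hde ha hb hab with h4 | h4 <;>
    rcases h.middle_eq hde ha hc hac with h5 | h5 <;>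
    rcases h.middle_eq hde hb hc hbc with h6 | h6
  · exact hbc (h4.trans h5.symm)
  · exact hbc (h4.trans h5.symm)
  · exact h3 (by linear_combination h5 - h6 - h4)
  · exact h.e_ne_zero (by linear_combination h5 - h6 - h4)
  · exact h.e_ne_zero (by linear_combination h4 + h6 - h5)
  · exact h3 (by linear_combination h4 + h6 - h5)
  · exact hbc (h4.trans h5.symm)
  · exact hbc (h4.trans h5.symm)

theorem card_isolated_le {m : ZMod n} (hm : m ∈ middles U e) : (isolated U e).card ≤ 1 := by
  have hm' := mem_middles.1 hm
  obtain ⟨A, hA, hmA⟩ := h.exists_mem _ hm'.1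
  have h1 := h.card_isolated_add_le hA (P := {m + (e : ZMod n), m - (e : ZMod n)}) ?_ ?_
  · rw [Finset.card_pair (h.add_ne_sub hde m)] at h1
    omega
  · intro x hx
    rw [Finset.mem_insert, Finset.mem_singleton] at hx
    rcases hx with rfl | rfl
    · exact Finset.mem_sdiff.2 ⟨hm'.2.1, h.add_notMem hA hmA⟩
    · exact Finset.mem_sdiff.2 ⟨hm'.2.2, h.sub_notMem hA hmA⟩
  · intro y hy x hx
    have hx := mem_isolated.1 hx
    rw [Finset.mem_insert, Finset.mem_singleton] at hy
    rcases hy with rfl | rfl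
    · constructor
      · rintro rfl
        exact hx.2.2.1 (by simpa using hm'.1)
      · intro h'
        rw [← add_right_cancel h'] at hx
        exact hx.2.2.1 hm'.2.2
    · constructor
      · rintro rfl
        exact hx.2.2.2 (by simpa using hm'.2.1)
      · intro h'
        apply hx.2.2.2
        rw [← h']
        simpa using hm'.1

/-- At least four `x ∈ U` have `x + e ∈ U`. Without middles all would be isolated, but at most three
are. With a middle at most one is, so there are two adjacent middles and one isolated pair, and
every bound used is attained. Each member misses a triple covering the path and the pair; there are
only six such triples. -/
theorem exists_isPathPair : ∃ m p, IsPathPair S d e F U m p := by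
  have := h.neZero
  have hX := h.card_filter_add_mem
  have hM2 := h.card_middles_le hde
  have hsub : (U.filter fun x => x + (e : ZMod n) ∈ U) ⊆
      isolated U e ∪ (middles U e ∪ (middles U e).image fun x => x - (e : ZMod n)) := by
    intro x hx
    rw [Finset.mem_filter] at hx
    rw [Finset.mem_union, Finset.mem_union]
    by_cases h1 : x - e ∈ U
    · exact Or.inr (Or.inl (mem_middles.2 ⟨hx.1, hx.2, h1⟩))
    · by_cases h2 : x + e + e ∈ U
      · exact Or.inr (Or.inr (Finset.mem_image.2 ⟨x + e, mem_middles.2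
          ⟨hx.2, h2, by simpa using hx.1⟩, by simp⟩))
      · exact Or.inl (mem_isolated.2 ⟨hx.1, hx.2, h1, h2⟩)
  have hcard := ((Finset.card_le_card hsub).trans (Finset.card_union_le _ _)).trans
    (Nat.add_le_add_left (Finset.card_union_le _ _) _)
  have himg := Finset.card_image_le (s := middles U e) (f := fun x => x - (e : ZMod n))
  obtain ⟨A₀, hA₀⟩ : F.Nonempty := Finset.card_pos.1 (by rw [h.card_F]; omega)
  have hI3 := h.card_isolated_add_le hA₀ (P := ∅) (Finset.empty_subset _) (by simp)
  have hne : (middles U e).Nonempty := by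
    by_contra hemp
    rw [Finset.not_nonempty_iff_eq_empty] at hemp
    rw [hemp] at hcard
    simp at hcard hI3
    omega
  obtain ⟨m₀, hm₀⟩ := hne
  have hI1 := h.card_isolated_le hde hm₀
  obtain ⟨m, hm, hm'⟩ : ∃ m, m ∈ middles U e ∧ m + (e : ZMod n) ∈ middles U e := by
    obtain ⟨a, ha, b, hb, hab⟩ := Finset.one_lt_card.1 (show 1 < (middles U e).card by omega)
    rcases h.middle_eq hde ha hb hab with rfl | rfl
    · exact ⟨a, ha, hb⟩
    · exact ⟨a - e, hb, by simpa using ha⟩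
  have hmm : m ≠ m + (e : ZMod n) := fun h' => h.e_ne_zero (by linear_combination - h')
  have hMeq : middles U e = {m, m + (e : ZMod n)} := by
    symm
    apply Finset.eq_of_subset_of_card_le
    · intro x hx
      rw [Finset.mem_insert, Finset.mem_singleton] at hx
      rcases hx with rfl | rfl <;> assumption
    · rw [Finset.card_pair hmm]; exact hM2
  have hsub' : (U.filter fun x => x + (e : ZMod n) ∈ U) ⊆
      isolated U e ∪ {m, m + (e : ZMod n), m - (e : ZMod n)} := by
    refine hsub.trans (Finset.union_subset_union le_rfl ?_)
    rw [hMeq]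
    intro x hx
    simp only [Finset.mem_union, Finset.mem_image, Finset.mem_insert, Finset.mem_singleton] at hx ⊢
    rcases hx with (hx | hx) | ⟨a, ha | ha, rfl⟩
    · exact Or.inl hx
    · exact Or.inr (Or.inl hx)
    · rw [ha]; simp
    · rw [ha]; simp
  have hcard' := (Finset.card_le_card hsub').trans (Finset.card_union_le _ _)
  have h3 : ({m, m + (e : ZMod n), m - (e : ZMod n)} : Finset (ZMod n)).card ≤ 3 :=
    Finset.card_le_three
  obtain ⟨p, hp⟩ : (isolated U e).Nonempty := Finset.card_pos.1 (by omega)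
  have hp := mem_isolated.1 hp
  -- The upper bound of four is attained, so no `x` and `x + e` are both outside `U`.
  have hZ : (Finset.univ.filter fun x => x ∉ U ∧ x + (e : ZMod n) ∉ U) = ∅ :=
    Finset.card_eq_zero.1 (by omega)
  have hm := mem_middles.1 hm
  have hm1 := mem_middles.1 hm'
  rw [add_sub_cancel_right] at hm1
  have hy1 : ∀ y, y = p ∨ y = p + (e : ZMod n) → y ∈ U := by
    rintro y (rfl | rfl)
    · exact hp.1
    · exact hp.2.1
  have hdist : ∀ y, y = p ∨ y = p + (e : ZMod n) →
      m ≠ y ∧ m + (e : ZMod n) ≠ y ∧ m - (e : ZMod n) ≠ y ∧ m + (e : ZMod n) + e ≠ y := by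
    rintro y (rfl | rfl)
    · refine ⟨?_, ?_, ?_, ?_⟩ <;> rintro rfl
      · exact hp.2.2.1 hm.2.2
      · exact hp.2.2.1 (by simpa using hm.1)
      · exact hp.2.2.2 (by simpa using hm.2.1)
      · exact hp.2.2.1 (by simpa using hm.2.1)
    · refine ⟨?_, ?_, ?_, ?_⟩ <;> intro h'
      · exact hp.2.2.2 (h' ▸ hm.2.1)
      · exact hp.2.2.2 (h' ▸ hm1.2.1)
      · exact hp.2.2.2 (by rw [← h']; simpa using hm.1)
      · exact hp.2.2.1 (by rw [← add_right_cancel h']; simpa using hm.1)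
  have hclass : ∀ A ∈ F, ∃ y, (y = p ∨ y = p + e) ∧ (A = U \ {m, m + (e : ZMod n), y} ∨
      A = U \ {m + (e : ZMod n), m - (e : ZMod n), y} ∨
      A = U \ {m, m + (e : ZMod n) + e, y}) := by
    intro A hA
    obtain ⟨y, hy, hyA⟩ : ∃ y, (y = p ∨ y = p + (e : ZMod n)) ∧ y ∉ A := by
      by_cases hpA : p ∈ A
      · exact ⟨p + e, Or.inr rfl, h.add_notMem hA hpA⟩
      · exact ⟨p, Or.inl rfl, hpA⟩
    obtain ⟨d1, d2, d3, d4⟩ := hdist y hy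
    refine ⟨y, hy, ?_⟩
    by_cases c1 : m ∈ A
    · exact Or.inr (Or.inl (h.eq_sdiff hA hm.2.1 hm.2.2 (hy1 y hy) (h.add_notMem hA c1)
        (h.sub_notMem hA c1) hyA (h.add_ne_sub hde m) d2 d3))
    · by_cases c2 : m + (e : ZMod n) ∈ A
      · exact Or.inr (Or.inr (h.eq_sdiff hA hm.1 hm1.2.1 (hy1 y hy) c1 (h.add_notMem hA c2) hyA
          (fun h' => h.two_e_ne_zero hde (by linear_combination - h')) d1 d4))
      · exact Or.inl (h.eq_sdiff hA hm.1 hm.2.1 (hy1 y hy) c1 c2 hyA hmm d1 d2)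
  have hFsub : F ⊆ (({p, p + (e : ZMod n)} : Finset (ZMod n)).image
      (fun y => U \ {m, m + (e : ZMod n), y})) ∪
      ((({p, p + (e : ZMod n)} : Finset (ZMod n)).image
        (fun y => U \ {m + (e : ZMod n), m - (e : ZMod n), y})) ∪
      (({p, p + (e : ZMod n)} : Finset (ZMod n)).image
        (fun y => U \ {m, m + (e : ZMod n) + e, y}))) := by
    intro A hA
    obtain ⟨y, hy, hA'⟩ := hclass A hA
    have hy' : y ∈ ({p, p + (e : ZMod n)} : Finset (ZMod n)) := by
      rwa [Finset.mem_insert, Finset.mem_singleton]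
    simp only [Finset.mem_union]
    rcases hA' with rfl | rfl | rfl
    · exact Or.inl (Finset.mem_image_of_mem _ hy')
    · exact Or.inr (Or.inl (Finset.mem_image_of_mem
        (fun y => U \ {m + (e : ZMod n), m - (e : ZMod n), y}) hy'))
    · exact Or.inr (Or.inr (Finset.mem_image_of_mem
        (fun y => U \ {m, m + (e : ZMod n) + e, y}) hy'))
  have hc2 : ∀ g : ZMod n → Finset (ZMod n),
      (({p, p + (e : ZMod n)} : Finset (ZMod n)).image g).card ≤ 2 := fun g =>
    Finset.card_image_le.trans Finset.card_le_two
  have hFeq := Finset.eq_of_subset_of_card_le hFsub (by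
    refine (Finset.card_union_le _ _).trans ((Nat.add_le_add_left (Finset.card_union_le _ _) _).trans
      ?_)
    rw [h.card_F]
    have := hc2 (fun y => U \ {m, m + (e : ZMod n), y})
    have := hc2 (fun y => U \ {m + (e : ZMod n), m - (e : ZMod n), y})
    have := hc2 (fun y => U \ {m, m + (e : ZMod n) + e, y})
    omega)
  refine ⟨m, p, h, hde, ?_, hm.1, hm.2.1, hp.1, hp.2.1, hp.2.2.1, hp.2.2.2, hdist, ?_, hclass⟩
  · intro z hz
    by_contra hz'
    have : z ∈ Finset.univ.filter fun x => x ∉ U ∧ x + (e : ZMod n) ∉ U := by simp [hz, hz']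
    rw [hZ] at this
    simp at this
  · intro y hy
    have hy' : y ∈ ({p, p + (e : ZMod n)} : Finset (ZMod n)) := by
      rwa [Finset.mem_insert, Finset.mem_singleton]
    rw [hFeq]
    simp only [Finset.mem_union]
    exact ⟨Or.inl (Finset.mem_image_of_mem _ hy'), Or.inr (Or.inl (Finset.mem_image_of_mem
        (fun y => U \ {m + (e : ZMod n), m - (e : ZMod n), y}) hy')),
        Or.inr (Or.inr (Finset.mem_image_of_mem
        (fun y => U \ {m, m + (e : ZMod n) + e, y}) hy'))⟩

end

end IsSixfold

end HamSystem

/-! ### The case `d ≠ e`: the path and the pair are impossible. -/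

namespace HamSystem

namespace IsSixfold

namespace IsPathPair

variable {n r : ℕ} {S : HamSystem n r} {d e : ℕ}
variable {F : Finset (Finset (ZMod n))} {U : Finset (ZMod n)} {m p : ZMod n}
-- `A'` loses at most `x` from `A`, so it still contains one of `u` and `v`, together with `w`.
theorem exists_two_of_subset {u v w x : ZMod n} (huv : u ≠ v) {A A' : Finset (ZMod n)} (hA : A ∈ F)
    (hA' : A' ∈ F) (hne : A ≠ A') (hu : u ∈ A) (hv : v ∈ A) (hw : w ∈ A) (hwx : w ≠ x)
    (hsub : ∀ z ∈ A, z ≠ x → z ∈ A') :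
    ∃ A ∈ F, ∃ B ∈ F, A ≠ B ∧ u ∈ A ∧ w ∈ A ∧ v ∈ B ∧ w ∈ B := by
  by_cases hux : u = x
  · exact ⟨A, hA, A', hA', hne, hu, hw, hsub v hv (fun h' => huv (hux.trans h'.symm)),
      hsub w hw hwx⟩
  · exact ⟨A', hA', A, hA, hne.symm, hsub u hu hux, hsub w hw hwx, hv, hw⟩

variable (h : IsPathPair S d e F U m p)
include h

theorem compl_sub {z : ZMod n} (hz : z ∉ U) : z - e ∈ U := by
  by_contra h'
  have := h.compl_add _ h'
  rw [sub_add_cancel] at this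
  exact hz this

/-- The missed end `y` of the pair is chosen away from `u` and `w`. On the path, if `u` or `w` is a
middle, its two neighbours are missed; otherwise both middles are. -/
theorem exists_mem_mem {u w : ZMod n} (hu : u ∈ U) (hw : w ∈ U) (h1 : w ≠ u + e)
    (h2 : w ≠ u - e) : ∃ A ∈ F, u ∈ A ∧ w ∈ A := by
  have he := h.e_ne_zero
  have h1' : u ≠ w - e := fun h' => h1 (by rw [h']; ring)
  have h2' : u ≠ w + e := fun h' => h2 (by rw [h']; ring)
  obtain ⟨y, hy, hyu, hyw⟩ : ∃ y, (y = p ∨ y = p + (e : ZMod n)) ∧ u ≠ y ∧ w ≠ y := by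
    by_cases c1 : u = p
    · exact ⟨p + e, Or.inr rfl, fun h' => he (by linear_combination c1 - h'),
        fun h' => h1 (by rw [h', c1])⟩
    · by_cases c2 : w = p
      · exact ⟨p + e, Or.inr rfl, fun h' => h2' (by rw [h', c2]),
          fun h' => he (by linear_combination c2 - h')⟩
      · exact ⟨p, Or.inl rfl, c1, c2⟩
  obtain ⟨m0, m1, m2⟩ := h.mem_F y hy
  have self_add : ∀ x : ZMod n, x ≠ x + e := fun x h' => he (by linear_combination - h')
  have self_sub : ∀ x : ZMod n, x ≠ x - e := fun x h' => he (by linear_combination h')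
  by_cases c1 : u = m ∨ w = m
  · refine ⟨_, m1, ?_, ?_⟩ <;>
      simp only [Finset.mem_sdiff, Finset.mem_insert, Finset.mem_singleton, not_or]
    · refine ⟨hu, ?_, ?_, hyu⟩
      · rcases c1 with rfl | rfl
        · exact self_add _
        · exact h2'
      · rcases c1 with rfl | rfl
        · exact self_sub _
        · exact h1'
    · refine ⟨hw, ?_, ?_, hyw⟩
      · rcases c1 with rfl | rfl
        · exact h1
        · exact self_add _
      · rcases c1 with rfl | rfl
        · exact h2
        · exact self_sub _
  rw [not_or] at c1
  by_cases c2 : u = m + e ∨ w = m + e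
  · refine ⟨_, m2, ?_, ?_⟩ <;>
      simp only [Finset.mem_sdiff, Finset.mem_insert, Finset.mem_singleton, not_or]
    · refine ⟨hu, c1.1, ?_, hyu⟩
      rcases c2 with h' | h'
      · rw [← h']; exact self_add _
      · rw [← h']; exact h2'
    · refine ⟨hw, c1.2, ?_, hyw⟩
      rcases c2 with h' | h'
      · rw [← h']; exact h1
      · rw [← h']; exact self_add _
  rw [not_or] at c2
  refine ⟨_, m0, ?_, ?_⟩ <;>
    simp only [Finset.mem_sdiff, Finset.mem_insert, Finset.mem_singleton, not_or]
  · exact ⟨hu, c1.1, c2.1, hyu⟩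
  · exact ⟨hw, c1.2, c2.2, hyw⟩

theorem exists_two {u v w : ZMod n} (hu : u ∈ U) (hv : v ∈ U) (hw : w ∈ U) (huv : u ≠ v)
    (h1 : w ≠ u + e) (h2 : w ≠ u - e) (h3 : w ≠ v + e) (h4 : w ≠ v - e) :
    ∃ A ∈ F, ∃ B ∈ F, A ≠ B ∧ u ∈ A ∧ w ∈ A ∧ v ∈ B ∧ w ∈ B := by
  have he := h.e_ne_zero
  obtain ⟨A, hA, huA, hwA⟩ := h.exists_mem_mem hu hw h1 h2
  obtain ⟨B, hB, hvB, hwB⟩ := h.exists_mem_mem hv hw h3 h4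
  by_cases hAB : A = B
  swap
  · exact ⟨A, hA, B, hB, hAB, huA, hwA, hvB, hwB⟩
  subst hAB
  obtain ⟨y, hy, hcase⟩ := h.eq_of_mem A hA
  obtain ⟨y', hy', hyy⟩ : ∃ y', (y' = p ∨ y' = p + (e : ZMod n)) ∧ y ≠ y' := by
    rcases hy with rfl | rfl
    · exact ⟨y + e, Or.inr rfl, fun h' => he (by linear_combination - h')⟩
    · exact ⟨p, Or.inl rfl, fun h' => he (by linear_combination h')⟩
  obtain ⟨n1, n2, n3, n4⟩ := h.ne_of_eq y hy
  obtain ⟨n1', n2', n3', n4'⟩ := h.ne_of_eq y' hy'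
  obtain ⟨f0, f1, f2⟩ := h.mem_F y hy
  obtain ⟨f0', f1', f2'⟩ := h.mem_F y' hy'
  have hyU : y ∈ U := by
    rcases hy with rfl | rfl
    · exact h.p_mem
    · exact h.p_add_mem
  have self_add : ∀ x : ZMod n, x ≠ x + e := fun x h' => he (by linear_combination - h')
  have self_sub : ∀ x : ZMod n, x ≠ x - e := fun x h' => he (by linear_combination h')
  have key : ∀ a b : ZMod n, A = U \ {a, b, y} → U \ {a, b, y'} ∈ F → y ≠ a → y ≠ b →
      w ≠ y' → ∃ A ∈ F, ∃ B ∈ F, A ≠ B ∧ u ∈ A ∧ w ∈ A ∧ v ∈ B ∧ w ∈ B := by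
    intro a b hAeq hF hya hyb hwy
    refine exists_two_of_subset huv hA hF ?_ huA hvB hwA hwy ?_
    · intro heq
      have : y ∈ A := by
        rw [heq]
        simp [hyU, hya, hyb, hyy]
      rw [hAeq] at this
      simp at this
    · intro z hz hzy
      rw [hAeq] at hz
      simp only [Finset.mem_sdiff, Finset.mem_insert, Finset.mem_singleton, not_or] at hz ⊢
      exact ⟨hz.1, hz.2.1, hz.2.2.1, hzy⟩
  -- Exchanging `y` for `y'` yields a second member that loses only `y'`. When this is `w`, the
  -- cover of the path is changed instead.
  by_cases hwy : w = y'
  · subst hwy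
    rcases hcase with hcase | hcase | hcase
    · refine exists_two_of_subset (x := m - e) huv hA f1 ?_ huA hvB hwA n3'.symm ?_
      · intro heq
        have : m ∈ A := by
          rw [heq]
          simp only [Finset.mem_sdiff, Finset.mem_insert, Finset.mem_singleton, not_or]
          exact ⟨h.mid_mem, self_add m, self_sub m, n1⟩
        rw [hcase] at this
        simp at this
      · intro z hz hzx
        rw [hcase] at hz
        simp only [Finset.mem_sdiff, Finset.mem_insert, Finset.mem_singleton, not_or] at hz ⊢
        exact ⟨hz.1, hz.2.2.1, hzx, hz.2.2.2⟩
    · refine exists_two_of_subset (x := m) huv hA f0 ?_ huA hvB hwA n1'.symm ?_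
      · intro heq
        have : m ∈ A := by
          rw [hcase]
          simp only [Finset.mem_sdiff, Finset.mem_insert, Finset.mem_singleton, not_or]
          exact ⟨h.mid_mem, self_add m, self_sub m, n1⟩
        rw [heq] at this
        simp at this
      · intro z hz hzx
        rw [hcase] at hz
        simp only [Finset.mem_sdiff, Finset.mem_insert, Finset.mem_singleton, not_or] at hz ⊢
        exact ⟨hz.1, hzx, hz.2.1, hz.2.2.2⟩
    · refine exists_two_of_subset (x := m + e) huv hA f0 ?_ huA hvB hwA n2'.symm ?_
      · intro heq
        have : m + (e : ZMod n) ∈ A := by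
          rw [hcase]
          simp only [Finset.mem_sdiff, Finset.mem_insert, Finset.mem_singleton, not_or]
          exact ⟨h.mid_add_mem, (self_add m).symm, self_add _, n2⟩
        rw [heq] at this
        simp at this
      · intro z hz hzx
        rw [hcase] at hz
        simp only [Finset.mem_sdiff, Finset.mem_insert, Finset.mem_singleton, not_or] at hz ⊢
        exact ⟨hz.1, hz.2.1, hzx, hz.2.2.2⟩
  · rcases hcase with hcase | hcase | hcase
    · exact key _ _ hcase f0' n1.symm n2.symm hwy
    · exact key _ _ hcase f1' n2.symm n3.symm hwy
    · exact key _ _ hcase f2' n1.symm n4.symm hwy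

theorem not_around {x : ZMod n} {j : ℕ} (hj1 : 1 < j) (hje : j < e) (hjd : j ≠ d)
    (hjde : j + d ≠ e + 1) (hx : x ∈ U) (hx' : x - e - 1 ∈ U) (hw : x - j ∈ U) : False := by
  have hd := h.two_le_d
  have hadd := h.add_eq
  have hc := h.cast_add
  have ne : ∀ a b : ℕ, a < n → b < n → a ≠ b → (a : ZMod n) ≠ b := fun a b ha hb hab h' =>
    hab (ZMod.natCast_inj_of_lt ha hb h')
  obtain ⟨A, hA, B, hB, hAB, h1, h2, h3, h4⟩ := h.exists_two hx hx' hw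
    (fun h' => ZMod.natCast_ne_zero_of_lt (n := n) (i := e + 1) (by omega) (by omega)
      (by push_cast; linear_combination h'))
    (fun h' => ne j d (by omega) (by omega) hjd (by linear_combination - h' - hc))
    (fun h' => ne j e (by omega) (by omega) (by omega) (by linear_combination - h'))
    (fun h' => ne j 1 (by omega) (by omega) (by omega) (by push_cast; linear_combination - h'))
    (fun h' => ne (j + d) (e + 1) (by omega) (by omega) hjde
      (by push_cast; linear_combination hc - h'))
  exact (h.extra A hA).not_triangle (h.extra B hB) hAB (by omega) hadd h.no_cycle (by omega)
    (by omega) h1 h3 h2 h4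

/-- Otherwise the arc from `p + e` to `p + e + d = p` takes the step from `p + j` to `p + j + 1`. It
can be broken there and closed by a member through `p + e` and `p + j + 1` and one through `p` and
`p + j`; these differ because no member contains both `p` and `p + e`. -/
theorem le_or_eq_of_consecutive {j : ℕ} (hj : j < n) (h1 : p + j ∈ U) (h2 : p + j + 1 ∈ U) :
    j ≤ e ∨ j = n - 1 := by
  by_contra! hc
  have hd := h.two_le_d
  have hadd := h.add_eq
  have hcast := h.cast_add
  have hjn : j + 1 < n := by omega
  have he := h.two_le_e
  obtain ⟨A, hA, hA1, hA2⟩ := h.exists_mem_mem h.p_add_mem h2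
    (fun h' => h.p_add_add_notMem (h' ▸ h2))
    (fun h' => ZMod.natCast_ne_zero_of_lt (n := n) (i := j + 1) (by omega) hjn
      (by push_cast; linear_combination h'))
  obtain ⟨B, hB, hB1, hB2⟩ := h.exists_mem_mem h.p_mem h1
    (fun h' => ZMod.natCast_ne_of_lt (n := n) hc.1 hj (by linear_combination - h'))
    (fun h' => h.p_sub_notMem (h' ▸ h1))
  have e1 : ((j - e : ℕ) : ZMod n) = j - e := Nat.cast_sub (by omega)
  refine (h.extra A hA).not_broken (h.extra B hB) (fun hAB => h.add_notMem hB hB1 (hAB ▸ hA1))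
    (d := d) (by omega) h.no_cycle (j := j - e) (by omega) hA1 ?_ ?_ ?_
  · convert hA2 using 1; rw [e1]; ring
  · convert hB2 using 1; rw [e1]; ring
  · convert hB1 using 1; linear_combination hcast

theorem exists_start : ∃ x ∈ U, x - 1 ∉ U := by
  have := h.neZero
  obtain ⟨b, hb⟩ : ∃ b, b ∉ U := by
    by_contra! hall
    have h1 := Finset.eq_univ_iff_forall.2 hall
    have h2 := h.card_U
    rw [h1, Finset.card_univ, ZMod.card] at h2
    have := h.n_eq
    have := h.three_le
    omega
  exact ZMod.exists_mem_sub_one_notMem h.zero_mem_U hb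

theorem sub_one_sub_mem {x : ZMod n} (hx1 : x - 1 ∉ U) : x - e - 1 ∈ U := by
  have := h.compl_sub hx1
  rwa [show x - 1 - (e : ZMod n) = x - e - 1 by ring] at this

theorem eq_of_lt (hde : d < e) {x : ZMod n} (hx : x ∈ U) (hx1 : x - 1 ∉ U) {j : ℕ} (hj1 : 1 ≤ j)
    (hj : j ≤ e) (hjU : x - j ∈ U) : j = e ∨ j = d ∨ j + d = e + 1 := by
  by_contra! hc
  have : j ≠ 1 := by
    rintro rfl
    rw [Nat.cast_one] at hjU
    exact hx1 hjU
  exact h.not_around (by omega) (by omega) hc.2.1 hc.2.2 hx (h.sub_one_sub_mem hx1) hjU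

/-- By `eq_of_lt`, `U` lies in `d` consecutive vertices from `x` on plus three others. Since `d ≤ r`
and `U.card = r + 3`, everything is equality. -/
theorem eq_of_start (hde : d < e) {x : ZMod n} (hx : x ∈ U) (hx1 : x - 1 ∉ U) :
    d = r ∧ x - d ∈ U ∧ ∀ i < d, x + (i : ZMod n) ∈ U := by
  have := h.neZero
  have hadd := h.add_eq
  have hn := h.n_eq
  set T : Finset (ZMod n) := (Finset.range d).image (fun i : ℕ => x + (i : ZMod n)) ∪
    {x - (e : ZMod n), x - (d : ZMod n), x - ((e + 1 - d : ℕ) : ZMod n)} with hT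
  have hUT : U ⊆ T := by
    intro u hu
    obtain ⟨q, hq, rfl⟩ := ZMod.exists_natCast_eq_sub x u
    by_cases hqd : q < d
    · exact Finset.mem_union_left _ (Finset.mem_image.2 ⟨q, Finset.mem_range.2 hqd, rfl⟩)
    · apply Finset.mem_union_right
      have e1 : x + (q : ZMod n) = x - ((n - q : ℕ) : ZMod n) := by
        rw [Nat.cast_sub hq.le, ZMod.natCast_self]; ring
      rw [e1] at hu ⊢
      rcases h.eq_of_lt hde hx hx1 (by omega) (by omega) hu with h1 | h1 | h1
      · rw [h1]; simp
      · rw [h1]; simp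
      · rw [show n - q = e + 1 - d by omega]; simp
  have hTcard : T.card ≤ d + 3 := by
    refine (Finset.card_union_le _ _).trans (Nat.add_le_add ?_ Finset.card_le_three)
    exact Finset.card_image_le.trans (by rw [Finset.card_range])
  have hle := Finset.card_le_card hUT
  rw [h.card_U] at hle
  have hUeq := Finset.eq_of_subset_of_card_le hUT (by rw [h.card_U]; omega)
  refine ⟨by omega, ?_, fun i hi => ?_⟩
  · rw [hUeq]
    apply Finset.mem_union_right
    simp
  · rw [hUeq]
    exact Finset.mem_union_left _ (Finset.mem_image.2 ⟨i, Finset.mem_range.2 hi, rfl⟩)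

/-- If `x` starts a run, so does `x - d`, and the run from there reaches `x - 1`. -/
theorem false_of_d_lt (hde : d < e) : False := by
  have hadd := h.add_eq
  have hn := h.n_eq
  have hr := h.three_le
  have hcast := h.cast_add
  obtain ⟨x, hx, hx1⟩ := h.exists_start
  obtain ⟨hdr, h1, -⟩ := h.eq_of_start hde hx hx1
  have h2 : x - d - 1 ∉ U := by
    intro h'
    have := h.eq_of_lt hde hx hx1 (j := d + 1) (by omega) (by omega)
      (by push_cast; rwa [← sub_sub])
    omega
  obtain ⟨-, -, h3⟩ := h.eq_of_start hde h1 h2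
  have h4 := h3 (d - 1) (by omega)
  rw [Nat.cast_sub (by omega), Nat.cast_one, show x - (d : ZMod n) + (d - 1) = x - 1 by ring] at h4
  exact hx1 h4

section

variable (hde : e < d)
include hde

/-- Translating by `e` and by `-e` gives two consecutive pairs inside `U`; `le_or_eq_of_consecutive`
for both leaves only this window. -/
theorem exists_eq_of_notMem {z : ZMod n} (hz : z ∉ U) (hz1 : z + 1 ∉ U) :
    ∃ c : ℕ, z = p + c ∧ n ≤ c + e + 1 ∧ c ≤ 2 * e := by
  have := h.neZero
  have hadd := h.add_eq
  have he := h.two_le_e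
  obtain ⟨c, hc, rfl⟩ := ZMod.exists_natCast_eq_sub p z
  refine ⟨c, rfl, ?_⟩
  have a1 := h.compl_add _ hz
  have a2 := h.compl_add _ hz1
  have b1 := h.compl_sub hz
  have b2 := h.compl_sub hz1
  have key1 : c + e < n → c + e ≤ e ∨ c + e = n - 1 := fun hlt =>
    h.le_or_eq_of_consecutive hlt (by convert a1 using 1; push_cast; ring)
      (by convert a2 using 1; push_cast; ring)
  have key2 : e ≤ c → c - e ≤ e ∨ c - e = n - 1 := fun hle =>
    h.le_or_eq_of_consecutive (by omega)
      (by convert b1 using 1; rw [Nat.cast_sub hle]; ring)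
      (by convert b2 using 1; rw [Nat.cast_sub hle]; ring)
  have key3 : c < e → c + n - e ≤ e ∨ c + n - e = n - 1 := fun hlt =>
    h.le_or_eq_of_consecutive (by omega)
      (by convert b1 using 1; rw [Nat.cast_sub (by omega), Nat.cast_add, ZMod.natCast_self]; ring)
      (by convert b2 using 1; rw [Nat.cast_sub (by omega), Nat.cast_add, ZMod.natCast_self]; ring)
  omega

theorem sub_notMem_of_start {x : ZMod n} (hx : x ∈ U) (hx1 : x - 1 ∉ U) {j : ℕ} (hj1 : 1 ≤ j)
    (hj : j < e) : x - j ∉ U := by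
  intro hjU
  have : j ≠ 1 := by
    rintro rfl
    rw [Nat.cast_one] at hjU
    exact hx1 hjU
  exact h.not_around (by omega) hj (by omega) (by omega) hx (h.sub_one_sub_mem hx1) hjU

theorem false_of_eq_two (he : e = 2) : False := by
  subst he
  have hadd := h.add_eq
  have hn := h.n_eq
  have hr := h.three_le
  have hout : ∀ z, z ∉ U → z + 1 ∈ U := by
    intro z hz
    by_contra hz1
    obtain ⟨c, -, h1, h2⟩ := h.exists_eq_of_notMem hde hz hz1
    omega
  have hadd2 : ∀ z, z ∉ U → z + 2 ∈ U := fun z hz => by simpa using h.compl_add z hz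
  have hin : ∀ j : ℕ, 3 ≤ j → j ≤ 5 → p + j ∈ U → p + j + 1 ∉ U := by
    intro j hj hj5 h1 h2
    have := h.le_or_eq_of_consecutive (by omega) h1 h2
    omega
  by_cases h3 : p + 3 ∈ U
  · have h4 : p + 4 ∉ U := by
      have := hin 3 (by omega) (by omega) (by simpa using h3)
      push_cast at this
      convert this using 1; ring_nf
    have h5 : p + 5 ∈ U := by
      convert hout _ h4 using 1; ring
    have h6 : p + 6 ∈ U := by
      convert hadd2 _ h4 using 1; ring
    apply hin 5 (by omega) (by omega) (by simpa using h5)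
    convert h6 using 1; push_cast; ring
  · have h4 : p + 4 ∈ U := by
      convert hout _ h3 using 1; ring
    have h5 : p + 5 ∈ U := by
      convert hadd2 _ h3 using 1; ring
    apply hin 4 (by omega) (by omega) (by simpa using h4)
    convert h5 using 1; push_cast; ring

/-- For `e ≥ 3` a gap of `U` has length at least two, so all gaps lie in the window of
`exists_eq_of_notMem`. This forces `n = 2 * e + 2`, hence `e = r`, and puts `p, …, p + e` into `U`.
Exactly two further elements `a < b` remain, and the spacing of starts leaves no place for them. -/
theorem false_of_lt_d : False := by
  have := h.neZero
  by_cases he2 : e = 2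
  · exact h.false_of_eq_two hde he2
  have hadd := h.add_eq
  have hn := h.n_eq
  have hr := h.three_le
  have he := h.two_le_e
  have hnot : ∀ c : ℕ, c < n → p + c ∉ U → n ≤ c + e + 1 ∧ c ≤ 2 * e + 1 := by
    intro c hc hcU
    by_cases h1 : p + c + 1 ∈ U
    · have h2 := h.sub_notMem_of_start hde h1 (by simpa using hcU) (j := 2) (by omega) (by omega)
      push_cast at h2
      rw [show p + (c : ZMod n) + 1 - 2 = p + c - 1 by ring] at h2
      obtain ⟨c', h3, h4, h5⟩ := h.exists_eq_of_notMem hde h2 (by simpa using hcU)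
      have h6 : (c : ZMod n) = ((c' + 1 : ℕ) : ZMod n) := by
        push_cast; linear_combination h3
      have := ZMod.natCast_inj_of_lt hc (by omega) h6
      omega
    · obtain ⟨c', h3, h4, h5⟩ := h.exists_eq_of_notMem hde hcU h1
      have := ZMod.natCast_inj_of_lt hc (by omega) (add_left_cancel h3)
      omega
  have hn2 : n = 2 * e + 2 := by
    by_contra hne
    have h1 : p + ((n - 2 : ℕ) : ZMod n) ∈ U := by
      by_contra h'
      have := hnot _ (by omega) h'
      omega
    have h2 : p + ((n - 1 : ℕ) : ZMod n) ∈ U := by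
      by_contra h'
      have := hnot _ (by omega) h'
      omega
    rw [show n - 1 = n - 2 + 1 by omega, Nat.cast_succ, ← add_assoc] at h2
    have := h.le_or_eq_of_consecutive (by omega) h1 h2
    omega
  have hin : ∀ c : ℕ, c ≤ e → p + c ∈ U := by
    intro c hc
    by_contra h'
    have := hnot _ (by omega) h'
    omega
  have hmore : 1 < (U \ (Finset.range (e + 1)).image fun c : ℕ => p + (c : ZMod n)).card := by
    have h1 := Finset.le_card_sdiff ((Finset.range (e + 1)).image fun c : ℕ => p + (c : ZMod n)) U
    have h2 := Finset.card_image_le (s := Finset.range (e + 1)) (f := fun c : ℕ => p + (c : ZMod n))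
    rw [Finset.card_range] at h2
    rw [h.card_U] at h1
    omega
  obtain ⟨a, b, hab, hbn, hea, haU, hbU⟩ : ∃ a b : ℕ, a < b ∧ b < n ∧ e < a ∧ p + (a : ZMod n) ∈ U ∧
      p + (b : ZMod n) ∈ U := by
    obtain ⟨x, hx, y, hy, hxy⟩ := Finset.one_lt_card.1 hmore
    obtain ⟨a, ha, rfl⟩ := ZMod.exists_natCast_eq_sub p x
    obtain ⟨b, hb, rfl⟩ := ZMod.exists_natCast_eq_sub p y
    rw [Finset.mem_sdiff] at hx hy
    have ha' : e < a := by
      by_contra h'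
      exact hx.2 (Finset.mem_image.2 ⟨a, Finset.mem_range.2 (by omega), rfl⟩)
    have hb' : e < b := by
      by_contra h'
      exact hy.2 (Finset.mem_image.2 ⟨b, Finset.mem_range.2 (by omega), rfl⟩)
    have hne : a ≠ b := fun h' => hxy (by rw [h'])
    rcases lt_or_gt_of_ne hne with hlt | hlt
    · exact ⟨a, b, hlt, hb, ha', hx.1, hy.1⟩
    · exact ⟨b, a, hlt, ha, hb', hy.1, hx.1⟩
  have hb1 : p + b - 1 ∉ U := by
    intro h'
    have e1 : p + ((b - 1 : ℕ) : ZMod n) = p + b - 1 := by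
      rw [Nat.cast_sub (by omega), Nat.cast_one]; ring
    have := h.le_or_eq_of_consecutive (j := b - 1) (by omega) (by rwa [e1])
      (by rw [e1]; simpa using hbU)
    omega
  have hba : e ≤ b - a := by
    by_contra h'
    apply h.sub_notMem_of_start hde hbU hb1 (j := b - a) (by omega) (by omega)
    rw [Nat.cast_sub hab.le]
    convert haU using 1
    ring
  -- From `a > e`, `b ≤ 2 * e + 1` and `b - a ≥ e`.
  have ha : a = e + 1 := by omega
  subst ha
  refine h.not_around (x := p + ((e + 1 : ℕ) : ZMod n)) (j := e - 1) (by omega) (by omega) (by omega)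
    (by omega) haU ?_ ?_
  · convert h.p_mem using 1; push_cast; ring
  · convert hin 2 (by omega) using 1
    rw [Nat.cast_sub (by omega)]; push_cast; ring

end

end IsPathPair

theorem not_isSixfold {n r : ℕ} {S : HamSystem n r} {d e : ℕ} {F : Finset (Finset (ZMod n))}
    {U : Finset (ZMod n)} (h : S.IsSixfold d e F U) : False := by
  rcases lt_trichotomy d e with hde | hde | hde
  · obtain ⟨m, p, hmp⟩ := h.exists_isPathPair hde.ne
    exact hmp.false_of_d_lt hde
  · subst hde
    exact h.false_of_antipodal
  · obtain ⟨m, p, hmp⟩ := h.exists_isPathPair hde.ne'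
    exact hmp.false_of_lt_d hde

end IsSixfold

theorem hasBergeCycle_of_six {n r : ℕ} {S : HamSystem n r} (hr3 : 3 ≤ r) (hn1 : 2 * r + 1 ≤ n)
    (hn2 : n ≤ 2 * r + 2) {F : Finset (Finset (ZMod n))} (hF : F.card = 6)
    (hext : ∀ A ∈ F, S.IsExtra A) (h0 : ∀ A ∈ F, (0 : ZMod n) ∈ A) {k : ℕ} (hk2 : 2 ≤ k)
    (hkn : k < n) : HasBergeCycle S.E k := by
  have : NeZero n := ⟨by omega⟩
  by_cases hk : k = 2
  · subst hk
    exact cycle_two_of_six hr3 hn2 hF hext h0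
  · by_contra hno
    obtain ⟨d, rfl⟩ : ∃ d, k = d + 1 := ⟨k - 1, by omega⟩
    obtain ⟨U, hU⟩ := exists_isSixfold hr3 hn1 hn2 (by omega) (show d + (n - d) = n by omega)
      (by omega) hno hF hext h0
    exact hU.not_isSixfold

end HamSystem

/-! ### Transfer between hypergraphs and `HamSystem`. -/

namespace Hypergraph.BergeCycle

variable {α : Type*} {H : Hypergraph α} {m r : ℕ}

/-- The hamiltonian cycle traversed from its `i₀`-th vertex on. -/
def position (C : H.BergeCycle (m + 1)) (i₀ i : ZMod (m + 1)) : α :=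
  C.vert (i₀ + i : ZMod (m + 1))

theorem position_injective (C : H.BergeCycle (m + 1)) (i₀ : ZMod (m + 1)) :
    Function.Injective (C.position i₀) :=
  C.vert_injective.comp (add_right_injective (i₀ : ZMod (m + 1)))

theorem vert_add_one_mem (C : H.BergeCycle (m + 1)) (i : Fin (m + 1)) :
    C.vert (i + 1) ∈ C.edge i := by
  have h := C.pair_subset i (Set.mem_insert_of_mem _ rfl)
  rwa [finRotate_apply] at h

open Classical in
/-- The set of positions on the cycle of the vertices in `s`. -/
noncomputable def positions (C : H.BergeCycle (m + 1)) (i₀ : ZMod (m + 1)) (s : Set α) :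
    Finset (ZMod (m + 1)) :=
  Finset.univ.filter fun i => C.position i₀ i ∈ s

theorem mem_positions {C : H.BergeCycle (m + 1)} {i₀ i : ZMod (m + 1)} {s : Set α} :
    i ∈ C.positions i₀ s ↔ C.position i₀ i ∈ s := by
  simp [positions]

theorem range_position (C : H.BergeCycle (m + 1)) (hfin : H.vertexSet.Finite)
    (hn : H.vertexSet.ncard = m + 1) (i₀ : ZMod (m + 1)) :
    Set.range (C.position i₀) = H.vertexSet := by
  apply Set.eq_of_subset_of_ncard_le _ _ hfin
  · rintro _ ⟨i, rfl⟩
    exact Hypergraph.subset_vertexSet_of_mem_edgeSet (C.edge_mem _)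
      (C.pair_subset (i₀ + i : ZMod (m + 1)) (Set.mem_insert _ _))
  · rw [hn, ← Set.image_univ, Set.ncard_image_of_injective _ (C.position_injective i₀),
      Set.ncard_univ, Nat.card_eq_fintype_card, ZMod.card]

theorem image_positions (C : H.BergeCycle (m + 1)) (hfin : H.vertexSet.Finite)
    (hn : H.vertexSet.ncard = m + 1) (i₀ : ZMod (m + 1)) {s : Set α} (hs : s ∈ H.edgeSet) :
    C.position i₀ '' (C.positions i₀ s : Set (ZMod (m + 1))) = s := by
  ext x
  constructor
  · rintro ⟨i, hi, rfl⟩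
    exact mem_positions.1 hi
  · intro hx
    have h1 : x ∈ Set.range (C.position i₀) := by
      rw [C.range_position hfin hn]
      exact Hypergraph.subset_vertexSet_of_mem_edgeSet hs hx
    obtain ⟨i, rfl⟩ := h1
    exact ⟨i, mem_positions.2 hx, rfl⟩

theorem positions_injOn (C : H.BergeCycle (m + 1)) (hfin : H.vertexSet.Finite)
    (hn : H.vertexSet.ncard = m + 1) (i₀ : ZMod (m + 1)) :
    Set.InjOn (C.positions i₀) H.edgeSet := fun s hs t ht hst => by
  rw [← C.image_positions hfin hn i₀ hs, hst, C.image_positions hfin hn i₀ ht]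

/-- The system of position sets of the edges of `H`. -/
noncomputable def hamSystem (C : H.BergeCycle (m + 1)) (hfin : H.vertexSet.Finite)
    (hn : H.vertexSet.ncard = m + 1) (hunif : H.IsUniformOfSize r) (i₀ : ZMod (m + 1)) :
    HamSystem (m + 1) r where
  E := C.positions i₀ '' H.edgeSet
  e i := C.positions i₀ (C.edge (i₀ + i : ZMod (m + 1)))
  e_injective i j hij := add_right_injective i₀ (C.edge_injective
    (C.positions_injOn hfin hn i₀ (C.edge_mem _) (C.edge_mem _) hij))
  e_mem i := ⟨_, C.edge_mem _, rfl⟩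
  left_mem i := mem_positions.2 (C.pair_subset (i₀ + i : ZMod (m + 1)) (Set.mem_insert _ _))
  right_mem i := by
    rw [mem_positions, position, ← add_assoc]
    exact C.vert_add_one_mem (i₀ + i : ZMod (m + 1))
  card_eq := by
    rintro _ ⟨s, hs, rfl⟩
    rw [← (hunif s hs).2, ← Set.ncard_coe_finset,
      ← Set.ncard_image_of_injective _ (C.position_injective i₀), C.image_positions hfin hn i₀ hs]

theorem nonempty_of_hasBergeCycle (C : H.BergeCycle (m + 1)) (hfin : H.vertexSet.Finite)
    (hn : H.vertexSet.ncard = m + 1) (hunif : H.IsUniformOfSize r) (i₀ : ZMod (m + 1)) {k : ℕ}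
    (h : HasBergeCycle (C.hamSystem hfin hn hunif i₀).E k) : Nonempty (H.BergeCycle k) := by
  obtain ⟨v, g, hv, hg, hvg⟩ := h
  choose s hs hsg using fun i => (hvg i).1
  refine ⟨⟨fun i => C.position i₀ (v i), s, (C.position_injective i₀).comp hv, ?_, hs, ?_⟩⟩
  · intro i j hij
    apply hg
    rw [← hsg i, ← hsg j, hij]
  · intro i x hx
    rw [Set.mem_insert_iff, Set.mem_singleton_iff] at hx
    obtain ⟨-, h1, h2⟩ := hvg i
    rw [← hsg i, mem_positions] at h1 h2
    rcases hx with rfl | rfl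
    · exact h1
    · exact h2

theorem isExtra_positions (C : H.BergeCycle (m + 1)) (hfin : H.vertexSet.Finite)
    (hn : H.vertexSet.ncard = m + 1) (hunif : H.IsUniformOfSize r) (i₀ : ZMod (m + 1)) {s : Set α}
    (hs : s ∈ H.edgeSet \ C.edges) :
    (C.hamSystem hfin hn hunif i₀).IsExtra (C.positions i₀ s) := by
  refine ⟨⟨s, hs.1, rfl⟩, fun i hi => hs.2 ?_⟩
  exact ⟨_, C.positions_injOn hfin hn i₀ (C.edge_mem _) hs.1 hi⟩

end Hypergraph.BergeCycle

theorem mainTheorem2 {α : Type*} (n r : ℕ) (hr3 : 3 ≤ r) (hr : (n - 1) / 2 ≤ r)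
    (H : Hypergraph α) (hfin : H.vertexSet.Finite) (hn : H.vertexSet.ncard = n)
    (hunif : H.IsUniformOfSize r) (C : H.BergeCycle n)
    (v : α) (hv : v ∈ H.vertexSet)
    (hdeg : extraEdgeBound n r ≤ {e | e ∈ H.edgeSet \ C.edges ∧ v ∈ e}.ncard) :
    H.IsPancyclic := by
  intro k hk2 hkn
  rw [hn] at hkn
  obtain ⟨m, rfl⟩ : ∃ m, n = m + 1 := by
    refine ⟨n - 1, ?_⟩
    have : 0 < n := hn ▸ (Set.ncard_pos hfin).2 ⟨v, hv⟩
    omega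
  rcases hkn.eq_or_lt with rfl | hlt
  · exact ⟨C⟩
  -- The cycle is started at `v`, so that `v` gets position `0`.
  obtain ⟨i₀, hi₀⟩ : ∃ i₀, C.position 0 i₀ = v := by
    have h1 := C.range_position hfin hn 0
    rw [← h1] at hv
    exact hv
  have hpos : C.position i₀ 0 = v := by
    rw [← hi₀, Hypergraph.BergeCycle.position, Hypergraph.BergeCycle.position, zero_add, add_zero]
  apply C.nonempty_of_hasBergeCycle hfin hn hunif i₀
  by_cases hcase : r = (m + 1 - 1) / 2
  · rw [extraEdgeBound_eq_six hcase] at hdeg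
    obtain ⟨t, ht, htcard⟩ := Set.exists_subset_card_eq hdeg
    have htfin : t.Finite := Set.finite_of_ncard_ne_zero (by omega)
    classical
    refine HamSystem.hasBergeCycle_of_six (F := htfin.toFinset.image (C.positions i₀)) hr3
      (by omega) (by omega) ?_ ?_ ?_ hk2 hlt
    · rw [Finset.card_image_of_injOn, ← Set.ncard_eq_toFinset_card t htfin, htcard]
      intro s hs s' hs' h
      rw [Set.Finite.coe_toFinset] at hs hs'
      exact C.positions_injOn hfin hn i₀ (ht hs).1.1 (ht hs').1.1 h
    · intro A hA
      obtain ⟨s, hs, rfl⟩ := Finset.mem_image.1 hA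
      exact C.isExtra_positions hfin hn hunif i₀ (ht (htfin.mem_toFinset.1 hs)).1
    · intro A hA
      obtain ⟨s, hs, rfl⟩ := Finset.mem_image.1 hA
      rw [Hypergraph.BergeCycle.mem_positions, hpos]
      exact (ht (htfin.mem_toFinset.1 hs)).2
  -- Here `r > (n - 1) / 2`, that is `n ≤ 2 * r`, and one extra edge suffices.
  · rw [extraEdgeBound, if_neg hcase] at hdeg
    obtain ⟨s, hs⟩ := Set.nonempty_of_ncard_ne_zero (s := {e | e ∈ H.edgeSet \ C.edges ∧ v ∈ e})
      (by omega)
    exact (C.isExtra_positions hfin hn hunif i₀ hs.1).hasBergeCycle_of_le_two_mul hr3 (by omega)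
      hk2 hlt
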